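/- Let $\mathfrak o$ be the lattice of integral octonions (Coxeter's order, spanned by $e_0,\ e_1,\ e_2,\ -e_4,\ \tfrac12(e_1+e_2+e_3+e_4),\ \tfrac12(-e_0-e_1-e_4+e_5),\ \tfrac12(-e_0+e_1-e_2+e_6),\ \tfrac12(-e_0+e_2+e_4+e_7)$, where $e_ie_{i+1}=e_{i+3}$ with indices modulo $7$). Let $\mathfrak J(\mathbb R)$ be the exceptional Jordan algebra of Hermitian octonionic $3\times 3$ matrices, with determinant $\det$ and trace form $(X,Y)=\mathrm{Tr}(\tfrac12(XY+YX))$, and let $\mathfrak J(\mathbb Z)\subset\mathfrak J(\mathbb R)$ be the lattice of matrices with diagonal entries in $\mathbb Z$ and off-diagonal entries in $\mathfrak o$. Let $R_3^+(\mathbb R)=\{X^2 : X\in\mathfrak J(\mathbb R),\ \det X\ne 0\}$ be the positive cone, $\mathfrak J(\mathbb Z)_{>0}=\mathfrak J(\mathbb Z)\cap R_3^+(\mathbb R)$ and $\mathfrak J(\mathbb Z)_{\ge 0}=\mathfrak J(\mathbb Z)\cap\overline{R_3^+(\mathbb R)}$. For $T\in\mathfrak J(\mathbb Z)$ let $T_1$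 be the half-integral symmetric real matrix obtained from $T$ by replacing each entry by its real part. Let $\mathfrak T=\{X+iY : X\in\mathfrak J(\mathbb R),\ Y\in R_3^+(\mathbb R)\}$ be the exceptional domain. A modular form of weight $k$ and level one on $\mathfrak T$ is a holomorphic function $F$ on $\mathfrak T$ with $F(\gamma Z)=j(\gamma,Z)^kF(Z)$ for all $\gamma\in E_{7,3}(\mathbb Z)$, where $j$ is the canonical factor of automorphy; $A_F(T)$ denotes its Fourier coefficients, $F(Z)=\sum_{T\in\mathfrak J(\mathbb Z)_{\ge 0}}A_F(T)e^{2\pi i(T,Z)}$. It is a cusp form if $\lim_{\mathrm{Im}\,\tau\to\infty}F\begin{pmatrix}Z'&0\\0&\tau\end{pmatrix}=0$ for every Hermitian octonionic $2\times 2$ matrix $Z'$ over $\mathbb C$ whose imaginary part is the square of a real matrix of nonzero determinant. Restricting $F$ to the Siegel upper half space $\mathbb H_3\subset\mathfrak T$ gives a function $F|_{Sp_6}$ with Fourier expansion $$F|_{Sp_6}(Z_1)=\sum_{S}A_{F|_{Sp_6}}(S)\,e^{2\pi i\,\mathrm{Tr}(SZ_1)},\qquad A_{F|_{Sp_6}}(S)=\sum_{T\in\mathfrak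 J(\mathbb Z)_{\ge 0},\ T_1=S}A_F(T),$$ where $S$ runs over the positive semidefinite half-integral symmetric $3\times3$ matrices (integral diagonal, off-diagonal entries in $\tfrac12\mathbb Z$). **Lemma.** Let $$S=\begin{pmatrix}1&\frac12&a\\ \frac12&1&b\\ a&b&c\end{pmatrix}$$ be positive semidefinite and half-integral. Then there is no $T\in\mathfrak J(\mathbb Z)_{>0}$ with $T_1=S$; the set of $T\in\mathfrak J(\mathbb Z)_{\ge 0}$ with $T_1=S$ is finite; and for every cusp form $F$ of level one and any weight $k \in \mathbb Z$ on $\mathfrak T$, $A_{F|_{Sp_6}}(S)=0$, that is, both the sum $\sum_{T\in\mathfrak J(\mathbb Z)_{\ge 0},\,T_1=S}A_F(T)$ and the Fourier coefficient of the function $F|_{Sp_6}$ at $S$ are equal to $0$. -/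

import Mathlib

noncomputable section

namespace ExcDomain

/-! ### Octonions -/

/-- The octonions `∑ xᵢ eᵢ` (`0 ≤ i ≤ 7`) with coordinates in `R`. -/
abbrev Oct (R : Type*) := Fin 8 → R

namespace Oct

variable {R : Type*} [CommRing R]

/-- Octonion multiplication: `e₀ = 1`, `eᵢ² = -1`, and `eᵢ eᵢ₊₁ = eᵢ₊₃ = -eᵢ₊₁ eᵢ` together with its
cyclic rotations, the indices `1, …, 7` being read modulo `7`. -/
def mul (x y : Oct R) : Oct R :=
  ![x 0 * y 0 - x 1 * y 1 - x 2 * y 2 - x 3 * y 3 - x 4 * y 4 - x 5 * y 5 - x 6 * y 6 - x 7 * y 7,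
    x 0 * y 1 + x 1 * y 0 + x 2 * y 4 + x 3 * y 7 - x 4 * y 2 + x 5 * y 6 - x 6 * y 5 - x 7 * y 3,
    x 0 * y 2 - x 1 * y 4 + x 2 * y 0 + x 3 * y 5 + x 4 * y 1 - x 5 * y 3 + x 6 * y 7 - x 7 * y 6,
    x 0 * y 3 - x 1 * y 7 - x 2 * y 5 + x 3 * y 0 + x 4 * y 6 + x 5 * y 2 - x 6 * y 4 + x 7 * y 1,
    x 0 * y 4 + x 1 * y 2 - x 2 * y 1 - x 3 * y 6 + x 4 * y 0 + x 5 * y 7 + x 6 * y 3 - x 7 * y 5,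
    x 0 * y 5 - x 1 * y 6 + x 2 * y 3 - x 3 * y 2 - x 4 * y 7 + x 5 * y 0 + x 6 * y 1 + x 7 * y 4,
    x 0 * y 6 + x 1 * y 5 - x 2 * y 7 + x 3 * y 4 - x 4 * y 3 - x 5 * y 1 + x 6 * y 0 + x 7 * y 2,
    x 0 * y 7 + x 1 * y 3 + x 2 * y 6 - x 3 * y 1 + x 4 * y 5 - x 5 * y 4 - x 6 * y 2 + x 7 * y 0]

/-- Octonion conjugation. -/
def conj (x : Oct R) : Oct R := fun i => if i = 0 then x 0 else -x i

/-- The norm `N(x) = ∑ xᵢ²`. -/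
def N (x : Oct R) : R := ∑ i, x i ^ 2

/-- The trace `Tr(x) = 2 x₀`. -/
def tr (x : Oct R) : R := 2 * x 0

/-- The scalar `r e₀`. -/
def scalar (r : R) : Oct R := fun i => if i = 0 then r else 0

/-- The basis `α₀, …, α₇` of the integral octonions. -/
def basis (K : Type*) [Field K] : Fin 8 → Oct K :=
  ![![1, 0, 0, 0, 0, 0, 0, 0],
    ![0, 1, 0, 0, 0, 0, 0, 0],
    ![0, 0, 1, 0, 0, 0, 0, 0],
    ![0, 0, 0, 0, -1, 0, 0, 0],
    ![0, 1 / 2, 1 / 2, 1 / 2, 1 / 2, 0, 0, 0],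
    ![-1 / 2, -1 / 2, 0, 0, -1 / 2, 1 / 2, 0, 0],
    ![-1 / 2, 1 / 2, -1 / 2, 0, 0, 0, 1 / 2, 0],
    ![-1 / 2, 0, 1 / 2, 0, 1 / 2, 0, 0, 1 / 2]]

/-- The lattice `𝔬` of integral octonions (inside the octonions over a field `K`). -/
def integral (K : Type*) [Field K] : Submodule ℤ (Oct K) := Submodule.span ℤ (Set.range (basis K))

end Oct

/-! ### The exceptional Jordan algebra -/

/-- The exceptional Jordan algebra: `(a, b, c, x, y, z)` stands for the Hermitian octonionic matrix
with rows `(a, x, y)`, `(x̄, b, z)`, `(ȳ, z̄, c)`. Only the additive and scalar structure of the product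
type is used. -/
abbrev J (R : Type*) := R × R × R × Oct R × Oct R × Oct R

namespace J

section Accessors
variable {R : Type*}

/-- The `(1,1)` entry. -/
def a (X : J R) : R := X.1
/-- The `(2,2)` entry. -/
def b (X : J R) : R := X.2.1
/-- The `(3,3)` entry. -/
def c (X : J R) : R := X.2.2.1
/-- The `(1,2)` entry. -/
def x (X : J R) : Oct R := X.2.2.2.1
/-- The `(1,3)` entry. -/
def y (X : J R) : Oct R := X.2.2.2.2.1
/-- The `(2,3)` entry. -/
def z (X : J R) : Oct R := X.2.2.2.2.2

end Accessors

open Oct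

variable {R : Type*} [CommRing R]

/-- The identity matrix. -/
def one (R : Type*) [CommRing R] : J R := (1, 1, 1, 0, 0, 0)

/-- The square `X · X = X ∘ X` (matrix multiplication). -/
def sq (X : J R) : J R :=
  (X.a ^ 2 + N X.x + N X.y, X.b ^ 2 + N X.x + N X.z, X.c ^ 2 + N X.y + N X.z,
    (X.a + X.b) • X.x + Oct.mul X.y (conj X.z),
    (X.a + X.c) • X.y + Oct.mul X.x X.z,
    (X.b + X.c) • X.z + Oct.mul (conj X.x) X.y)

/-- The product `X × X`. -/
def sharp (X : J R) : J R :=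
  (X.b * X.c - N X.z, X.a * X.c - N X.y, X.a * X.b - N X.x,
    Oct.mul X.y (conj X.z) - X.c • X.x,
    Oct.mul X.x X.z - X.b • X.y,
    Oct.mul (conj X.x) X.y - X.a • X.z)

/-- The determinant `abc - a N(z) - b N(y) - c N(x) + Tr((xz)ȳ)`. -/
def det (X : J R) : R :=
  X.a * X.b * X.c - X.a * N X.z - X.b * N X.y - X.c * N X.x
    + tr (Oct.mul (Oct.mul X.x X.z) (conj X.y))

/-- The trace form `(X, Y) = Tr(X ∘ Y)`, where `X ∘ Y = (X · Y + Y · X) / 2`. -/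
def pairing (X Y : J R) : R :=
  X.a * Y.a + X.b * Y.b + X.c * Y.c
    + tr (Oct.mul X.x (conj Y.x)) + tr (Oct.mul X.y (conj Y.y)) + tr (Oct.mul X.z (conj Y.z))

/-- The lattice `𝔍(ℤ)`: diagonal entries in `ℤ`, off-diagonal entries in `𝔬`. -/
def integral (K : Type*) [Field K] : Set (J K) :=
  {X | (∃ n : ℤ, X.a = n) ∧ (∃ n : ℤ, X.b = n) ∧ (∃ n : ℤ, X.c = n) ∧
    X.x ∈ Oct.integral K ∧ X.y ∈ Oct.integral K ∧ X.z ∈ Oct.integral K}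

/-- The positive cone `R₃⁺(ℝ)`: squares of the elements of nonzero determinant. -/
def posCone : Set (J ℝ) := {T | ∃ X : J ℝ, X.det ≠ 0 ∧ T = X.sq}

/-- `𝔍(ℤ)_{>0}`. -/
def integralPos : Set (J ℝ) := integral ℝ ∩ posCone

/-- `𝔍(ℤ)_{≥0}`. -/
def integralNonneg : Set (J ℝ) := integral ℝ ∩ closure posCone

/-- `T₁`: the real symmetric matrix left when the imaginary octonion part of `T` is dropped. -/
def symPart (T : J ℝ) : Matrix (Fin 3) (Fin 3) ℝ :=
  !![T.a, T.x 0, T.y 0; T.x 0, T.b, T.z 0; T.y 0, T.z 0, T.c]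

/-- The element `X + i Y` of the complexified algebra. -/
def toComplex (X Y : J ℝ) : J ℂ :=
  (X.a + Y.a * Complex.I, X.b + Y.b * Complex.I, X.c + Y.c * Complex.I,
    fun i => X.x i + Y.x i * Complex.I, fun i => X.y i + Y.y i * Complex.I,
    fun i => X.z i + Y.z i * Complex.I)

/-- The coordinatewise imaginary part of an element of the complexified algebra. -/
def im (Z : J ℂ) : J ℝ :=
  (Z.a.im, Z.b.im, Z.c.im, fun i => (Z.x i).im, fun i => (Z.y i).im, fun i => (Z.z i).im)

end J

/-- The exceptional domain `𝔗 = {X + iY : Y ∈ R₃⁺(ℝ)}`. -/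
def domain : Set (J ℂ) := {Z | Z.im ∈ J.posCone}

/-! ### The group `E_{7,3}(ℤ)` and its automorphy factor -/

/-- The 56-dimensional space of quadruples `(X, ξ, X', ξ')`. -/
abbrev W := J ℂ × ℂ × J ℂ × ℂ

/-- The quartic form
`(X × X, X' × X') - ξ det X - ξ' det X' - ((X, X') - ξ ξ')² / 4`. -/
def quartic (w : W) : ℂ :=
  J.pairing w.1.sharp w.2.2.1.sharp - w.2.1 * w.1.det - w.2.2.2 * w.2.2.1.det
    - (J.pairing w.1 w.2.2.1 - w.2.1 * w.2.2.2) ^ 2 / 4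

/-- The alternating form `(X₁, X₂') - (X₂, X₁') + ξ₁ ξ₂' - ξ₂ ξ₁'`. -/
def symp (w v : W) : ℂ :=
  J.pairing w.1 v.2.2.1 - J.pairing v.1 w.2.2.1 + w.2.1 * v.2.2.2 - v.2.1 * w.2.2.2

/-- The lattice `𝔍(ℤ) ⊕ ℤ ⊕ 𝔍(ℤ) ⊕ ℤ`. -/
def latticeW : Set W :=
  {w | w.1 ∈ J.integral ℂ ∧ (∃ n : ℤ, w.2.1 = n) ∧ w.2.2.1 ∈ J.integral ℂ ∧ ∃ n : ℤ, w.2.2.2 = n}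

/-- `E_{7,3}(ℤ)`: the linear automorphisms of the 56-dimensional space which preserve the quartic form,
the alternating form and the lattice. (The lattice spans, so such maps are automatically defined over
`ℚ`.) -/
def Gamma : Subgroup (W ≃ₗ[ℂ] W) where
  carrier := {g | (∀ w, quartic (g w) = quartic w) ∧ (∀ w v, symp (g w) (g v) = symp w v) ∧
    ∀ w, g w ∈ latticeW ↔ w ∈ latticeW}
  mul_mem' := by
    rintro g h ⟨hg1, hg2, hg3⟩ ⟨hh1, hh2, hh3⟩
    exact ⟨fun w => (hg1 _).trans (hh1 w), fun w v => (hg2 _ _).trans (hh2 w v),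
      fun w => (hg3 _).trans (hh3 w)⟩
  one_mem' := ⟨fun _ => rfl, fun _ _ => rfl, fun _ => Iff.rfl⟩
  inv_mem' := by
    rintro g ⟨hg1, hg2, hg3⟩
    have key : ∀ w, g (g⁻¹ w) = w := fun w => g.apply_symm_apply w
    refine ⟨fun w => ?_, fun w v => ?_, fun w => ?_⟩
    · rw [← hg1, key]
    · rw [← hg2, key, key]
    · rw [← hg3, key]

/-- The vector `(Z, det Z, Z × Z, 1)`. The action of the group on the exceptional domain and the
canonical automorphy factor `j` are given by `g · toW Z = j(g, Z) • toW (g Z)`. -/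
def toW (Z : J ℂ) : W := (Z, Z.det, Z.sharp, 1)

/-! ### Modular forms and cusp forms -/

/-- Modular forms of weight `k` and level one on the exceptional domain: holomorphic functions with
`F(g Z) = j(g, Z)ᵏ F(Z)` for `g ∈ E_{7,3}(ℤ)`; here `Z'` is `g Z` and `j` is `j(g, Z)`. -/
structure IsModularForm (k : ℤ) (F : J ℂ → ℂ) : Prop where
  holo : DifferentiableOn ℂ F domain
  transform : ∀ g ∈ Gamma, ∀ Z ∈ domain, ∀ Z' ∈ domain, ∀ j : ℂ,
    g (toW Z) = j • toW Z' → F Z' = j ^ k * F Z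

/-- The Hermitian octonionic `2 × 2` matrices: `(a, b, x)` has rows `(a, x)`, `(x̄, b)`. -/
abbrev J2 (R : Type*) := R × R × Oct R

/-- The positive cone of `2 × 2` matrices: squares of the matrices of nonzero determinant
`ab - N(x)`. -/
def posCone2 : Set (J2 ℝ) :=
  {T | ∃ (a b : ℝ) (x : Oct ℝ), a * b - Oct.N x ≠ 0 ∧
    T = (a ^ 2 + Oct.N x, b ^ 2 + Oct.N x, (a + b) • x)}

/-- The domain `𝔗₂` of `2 × 2` matrices with imaginary part in the positive cone. -/
def domain2 : Set (J2 ℂ) := {Z | (Z.1.im, Z.2.1.im, fun i => (Z.2.2 i).im) ∈ posCone2}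

/-- The block diagonal matrix with blocks `Z` and `τ`. -/
def block (Z : J2 ℂ) (τ : ℂ) : J ℂ := (Z.1, Z.2.1, τ, Z.2.2, 0, 0)

/-- Cusp forms of weight `k` and level one: modular forms with `Φ(F) = 0`, where
`Φ(F)(Z) = lim F(diag(Z, τ))` as `Im τ → ∞`. -/
structure IsCuspForm (k : ℤ) (F : J ℂ → ℂ) : Prop extends IsModularForm k F where
  cusp : ∀ Z ∈ domain2, Filter.Tendsto (fun τ : ℂ => F (block Z τ))
    (Filter.comap Complex.im Filter.atTop) (nhds 0)

/-! ### Fourier coefficients -/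

/-- The coordinates of `𝔍(ℝ) ≅ ℝ²⁷` with respect to the `ℤ`-basis of `𝔍(ℤ)` that consists of the three
diagonal units and of `α₀, …, α₇` in each of the three off-diagonal places. -/
def ofCoords (t : Fin 3 ⊕ Fin 3 × Fin 8 → ℝ) : J ℝ :=
  (t (Sum.inl 0), t (Sum.inl 1), t (Sum.inl 2),
    ∑ i, t (Sum.inr (0, i)) • Oct.basis ℝ i,
    ∑ i, t (Sum.inr (1, i)) • Oct.basis ℝ i,
    ∑ i, t (Sum.inr (2, i)) • Oct.basis ℝ i)

/-- The Fourier coefficient `A_F(T)` in `F(Z) = ∑ A_F(T) e^{2πi (T, Z)}`: the integral of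
`F(Z) e^{-2πi (T, Z)}`, `Z = X + i`, over `X ∈ 𝔍(ℝ) / 𝔍(ℤ)` (of total volume one; for a modular form the
base point `i` may be replaced by `iY` with any `Y` in the positive cone). -/
def fourierCoeff (F : J ℂ → ℂ) (T : J ℝ) : ℂ :=
  ∫ t in Set.Icc (0 : Fin 3 ⊕ Fin 3 × Fin 8 → ℝ) 1,
    F (J.toComplex (ofCoords t) (J.one ℝ)) *
      Complex.exp (-(2 * Real.pi * Complex.I *
        J.pairing (J.toComplex T 0) (J.toComplex (ofCoords t) (J.one ℝ))))

/-- `∑ A_F(T)` over the `T ∈ 𝔍(ℤ)_{≥0}` with `T₁ = S`. -/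
def restrictedCoeff (F : J ℂ → ℂ) (S : Matrix (Fin 3) (Fin 3) ℝ) : ℂ :=
  ∑ᶠ T ∈ {T : J ℝ | T ∈ J.integralNonneg ∧ T.symPart = S}, fourierCoeff F T

/-! ### Restriction to the Siegel upper half space -/

/-- The embedding of the Siegel upper half space of degree three (symmetric matrices `Z` with positive
definite imaginary part) into the exceptional domain. -/
def siegelEmbed (Z : Matrix (Fin 3) (Fin 3) ℂ) : J ℂ :=
  (Z 0 0, Z 1 1, Z 2 2, Oct.scalar (Z 0 1), Oct.scalar (Z 0 2), Oct.scalar (Z 1 2))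

/-- The restriction of `F` to the Siegel upper half space. -/
def restrict (F : J ℂ → ℂ) : Matrix (Fin 3) (Fin 3) ℂ → ℂ := fun Z => F (siegelEmbed Z)

/-- The symmetric matrix with diagonal `t₀, t₁, t₂` and off-diagonal entries `t₃, t₄, t₅` in the places
`(1,2)`, `(1,3)`, `(2,3)`, plus `i` times the identity. -/
def siegelPoint (t : Fin 6 → ℝ) : Matrix (Fin 3) (Fin 3) ℂ :=
  !![(t 0 : ℂ) + Complex.I, (t 3 : ℂ), (t 4 : ℂ);
    (t 3 : ℂ), (t 1 : ℂ) + Complex.I, (t 5 : ℂ);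
    (t 4 : ℂ), (t 5 : ℂ), (t 2 : ℂ) + Complex.I]

/-- The Fourier coefficient at `S` of a function `G(Z) = ∑ A(S) e^{2πi Tr(SZ)}` on the Siegel upper half
space of degree three: the integral of `G(Z) e^{-2πi Tr(SZ)}`, `Z = X + i`, over the real symmetric
matrices `X` modulo the integral ones. -/
def siegelFourierCoeff (G : Matrix (Fin 3) (Fin 3) ℂ → ℂ) (S : Matrix (Fin 3) (Fin 3) ℝ) : ℂ :=
  ∫ t in Set.Icc (0 : Fin 6 → ℝ) 1,
    G (siegelPoint t) *
      Complex.exp (-(2 * Real.pi * Complex.I * (S.map Complex.ofReal * siegelPoint t).trace))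

/-- `Sym³(ℤ)_{≥0}`: the positive semidefinite half-integral symmetric `3 × 3` matrices (integral diagonal,
off-diagonal entries in `ℤ / 2`). -/
def halfIntegralNonneg : Set (Matrix (Fin 3) (Fin 3) ℝ) :=
  {S | S.PosSemidef ∧ (∀ i, ∃ n : ℤ, S i i = n) ∧ ∀ i j, ∃ n : ℤ, S i j = (n : ℝ) / 2}

end ExcDomain

end

/-! If `T₁ = S`, the upper left block of `T` has diagonal `1, 1` and off-diagonal entry `x` in `𝔬`
with real part `1/2`. So `x ≠ 0`, its norm is a positive integer, and the minor `1 - N(x)` is at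
most `0`. On the positive cone this minor is positive (`posCone_minor_pos`), so no such `T` is
positive. On the closure of the cone the `2 × 2` minors are nonnegative, so the diagonal bounds all
entries and only finitely many `T` remain.

For a cusp form every single `A_F(T)` vanishes, for all integral `T` with `a = b = 1` and `Re x =
1/2`, semidefinite or not (`IsCuspForm.fourierCoeff_eq_zero`). The coefficients are invariant under
`shear v` with `v` in `𝔬` (`fourierCoeff_shear`), and `v = -x` clears `x` and replaces `b` by `1 -
N(x)`. A negative diagonal entry, or a zero diagonal entry with something nonzero in its row, forces
`A_F(T) = 0` by Koecher's argument: shears send the trace of `T` to `-∞`, while `|A_F(T)| ≤ C e^{2π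
tr T}`. Otherwise the second row and column are zero, and after a permutation `A_F(T)` is a Fourier
coefficient of `Φ(F) = 0` (`fourierCoeff_eq_zero_of_block`).

The coefficient of `F|_{Sp₆}` at `S` is obtained without proving that the Fourier expansion of `F`
converges. It is an integral over a subtorus of `𝔍(ℝ)/𝔍(ℤ)`. Viewed as a function of the
complementary variables, this integral is continuous and its Fourier coefficients are multiples of
the `A_F(T + D)`, all of them zero; a continuous function with finitely many nonzero Fourier
coefficients is the sum of its Fourier series (`IsPeriodic.integral_slice`). -/

noncomputable section

namespace ExcDomain

/-! ### Identities of the octonions over a commutative ring -/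

namespace Oct

variable {R : Type*} [CommRing R]

/-- The bilinear form `Tr(x ȳ)` attached to the norm. -/
def bil (x y : Oct R) : R := tr (mul x (conj y))

/-- The trilinear form `Tr((x z) ȳ)`. -/
def tri (x z y : Oct R) : R := tr (mul (mul x z) (conj y))

@[simp] lemma conj_zero_apply (x : Oct R) : conj x 0 = x 0 := rfl
@[simp] lemma conj_one_apply (x : Oct R) : conj x 1 = -x 1 := rfl
@[simp] lemma conj_two_apply (x : Oct R) : conj x 2 = -x 2 := rfl
@[simp] lemma conj_three_apply (x : Oct R) : conj x 3 = -x 3 := rfl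
@[simp] lemma conj_four_apply (x : Oct R) : conj x 4 = -x 4 := rfl
@[simp] lemma conj_five_apply (x : Oct R) : conj x 5 = -x 5 := rfl
@[simp] lemma conj_six_apply (x : Oct R) : conj x 6 = -x 6 := rfl
@[simp] lemma conj_seven_apply (x : Oct R) : conj x 7 = -x 7 := rfl

section MulApply
variable (x y : Oct R)

lemma mul_apply_zero : mul x y 0 = x 0 * y 0 - x 1 * y 1 - x 2 * y 2 - x 3 * y 3 - x 4 * y 4
    - x 5 * y 5 - x 6 * y 6 - x 7 * y 7 := rfl
lemma mul_apply_one : mul x y 1 = x 0 * y 1 + x 1 * y 0 + x 2 * y 4 + x 3 * y 7 - x 4 * y 2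
    + x 5 * y 6 - x 6 * y 5 - x 7 * y 3 := rfl
lemma mul_apply_two : mul x y 2 = x 0 * y 2 - x 1 * y 4 + x 2 * y 0 + x 3 * y 5 + x 4 * y 1
    - x 5 * y 3 + x 6 * y 7 - x 7 * y 6 := rfl
lemma mul_apply_three : mul x y 3 = x 0 * y 3 - x 1 * y 7 - x 2 * y 5 + x 3 * y 0 + x 4 * y 6
    + x 5 * y 2 - x 6 * y 4 + x 7 * y 1 := rfl
lemma mul_apply_four : mul x y 4 = x 0 * y 4 + x 1 * y 2 - x 2 * y 1 - x 3 * y 6 + x 4 * y 0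
    + x 5 * y 7 + x 6 * y 3 - x 7 * y 5 := rfl
lemma mul_apply_five : mul x y 5 = x 0 * y 5 - x 1 * y 6 + x 2 * y 3 - x 3 * y 2 - x 4 * y 7
    + x 5 * y 0 + x 6 * y 1 + x 7 * y 4 := rfl
lemma mul_apply_six : mul x y 6 = x 0 * y 6 + x 1 * y 5 - x 2 * y 7 + x 3 * y 4 - x 4 * y 3
    - x 5 * y 1 + x 6 * y 0 + x 7 * y 2 := rfl
lemma mul_apply_seven : mul x y 7 = x 0 * y 7 + x 1 * y 3 + x 2 * y 6 - x 3 * y 1 + x 4 * y 5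
    - x 5 * y 4 - x 6 * y 2 + x 7 * y 0 := rfl

end MulApply

lemma ext8 {S : Type*} {x y : Oct S} (h0 : x 0 = y 0) (h1 : x 1 = y 1) (h2 : x 2 = y 2)
    (h3 : x 3 = y 3) (h4 : x 4 = y 4) (h5 : x 5 = y 5) (h6 : x 6 = y 6) (h7 : x 7 = y 7) :
    x = y := by
  funext i
  fin_cases i <;> assumption

lemma N_eq (x : Oct R) : N x = x 0 ^ 2 + x 1 ^ 2 + x 2 ^ 2 + x 3 ^ 2 + x 4 ^ 2 + x 5 ^ 2 + x 6 ^ 2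
    + x 7 ^ 2 := by
  simp [N, Fin.sum_univ_eight]

lemma bil_eq (x y : Oct R) : bil x y = 2 * (x 0 * y 0 + x 1 * y 1 + x 2 * y 2 + x 3 * y 3
    + x 4 * y 4 + x 5 * y 5 + x 6 * y 6 + x 7 * y 7) := by
  simp only [bil, tr, mul_apply_zero, conj_zero_apply, conj_one_apply, conj_two_apply,
    conj_three_apply, conj_four_apply, conj_five_apply, conj_six_apply, conj_seven_apply]
  ring

section Linear
variable (x y z w : Oct R) (r : R)

@[simp] lemma conj_conj : conj (conj x) = x := by
  apply ext8 <;> simp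
@[simp] lemma conj_add : conj (x + y) = conj x + conj y := by
  apply ext8 <;> simp [add_comm]
@[simp] lemma conj_sub : conj (x - y) = conj x - conj y := by
  apply ext8 <;> simp <;> ring
@[simp] lemma conj_neg : conj (-x) = -conj x := by
  apply ext8 <;> simp
@[simp] lemma conj_smul : conj (r • x) = r • conj x := by
  apply ext8 <;> simp
@[simp] lemma conj_zero : conj (0 : Oct R) = 0 := by
  apply ext8 <;> simp

lemma add_mul' : mul (x + y) z = mul x z + mul y z := by
  apply ext8 <;> simp only [mul_apply_zero, mul_apply_one, mul_apply_two, mul_apply_three,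
    mul_apply_four, mul_apply_five, mul_apply_six, mul_apply_seven, Pi.add_apply] <;> ring
lemma mul_add' : mul x (y + z) = mul x y + mul x z := by
  apply ext8 <;> simp only [mul_apply_zero, mul_apply_one, mul_apply_two, mul_apply_three,
    mul_apply_four, mul_apply_five, mul_apply_six, mul_apply_seven, Pi.add_apply] <;> ring
lemma mul_smul_left : mul (r • x) y = r • mul x y := by
  apply ext8 <;> simp only [mul_apply_zero, mul_apply_one, mul_apply_two, mul_apply_three,
    mul_apply_four, mul_apply_five, mul_apply_six, mul_apply_seven, Pi.smul_apply,
    smul_eq_mul] <;> ring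
lemma mul_smul_right : mul x (r • y) = r • mul x y := by
  apply ext8 <;> simp only [mul_apply_zero, mul_apply_one, mul_apply_two, mul_apply_three,
    mul_apply_four, mul_apply_five, mul_apply_six, mul_apply_seven, Pi.smul_apply,
    smul_eq_mul] <;> ring
@[simp] lemma neg_mul' : mul (-x) y = -mul x y := by
  simpa using mul_smul_left x y (-1)
@[simp] lemma mul_neg' : mul x (-y) = -mul x y := by
  simpa using mul_smul_right x y (-1)
lemma sub_mul' : mul (x - y) z = mul x z - mul y z := by
  rw [sub_eq_add_neg, add_mul', neg_mul', ← sub_eq_add_neg]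
lemma mul_sub' : mul x (y - z) = mul x y - mul x z := by
  rw [sub_eq_add_neg, mul_add', mul_neg', ← sub_eq_add_neg]
@[simp] lemma mul_zero' : mul x 0 = 0 := by
  simpa using mul_smul_right x (0 : Oct R) 0

@[simp] lemma conj_of_mul : conj (mul x y) = mul (conj y) (conj x) := by
  apply ext8 <;> simp [mul_apply_zero, mul_apply_one, mul_apply_two, mul_apply_three,
    mul_apply_four, mul_apply_five, mul_apply_six, mul_apply_seven] <;> ring

lemma bil_comm : bil x y = bil y x := by simp only [bil_eq]; ring
lemma bil_add_left : bil (x + y) z = bil x z + bil y z := by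
  simp only [bil_eq, Pi.add_apply]; ring
lemma bil_smul_left : bil (r • x) y = r * bil x y := by
  simp only [bil_eq, Pi.smul_apply, smul_eq_mul]; ring
@[simp] lemma bil_neg_left : bil (-x) y = -bil x y := by
  simp only [bil_eq, Pi.neg_apply]; ring
lemma bil_sub_left : bil (x - y) z = bil x z - bil y z := by
  simp only [bil_eq, Pi.sub_apply]; ring
lemma bil_add_right : bil x (y + z) = bil x y + bil x z := by
  simp only [bil_eq, Pi.add_apply]; ring
lemma bil_smul_right : bil x (r • y) = r * bil x y := by
  simp only [bil_eq, Pi.smul_apply, smul_eq_mul]; ring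
lemma bil_sub_right : bil x (y - z) = bil x y - bil x z := by
  simp only [bil_eq, Pi.sub_apply]; ring
@[simp] lemma bil_zero_left : bil 0 x = 0 := by simp [bil_eq]
@[simp] lemma bil_zero_right : bil x 0 = 0 := by simp [bil_eq]
@[simp] lemma bil_conj_conj : bil (conj x) (conj y) = bil x y := by
  simp [bil_eq]
lemma bil_self : bil x x = 2 * N x := by simp only [bil_eq, N_eq]; ring

lemma N_add : N (x + y) = N x + bil x y + N y := by
  simp only [bil_eq, N_eq, Pi.add_apply]; ring
lemma N_sub : N (x - y) = N x - bil x y + N y := by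
  simp only [bil_eq, N_eq, Pi.sub_apply]; ring
lemma N_smul : N (r • x) = r ^ 2 * N x := by
  simp only [N_eq, Pi.smul_apply, smul_eq_mul]; ring
@[simp] lemma N_neg : N (-x) = N x := by simp [N_eq]
@[simp] lemma N_zero : N (0 : Oct R) = 0 := by simp [N_eq]
@[simp] lemma N_conj : N (conj x) = N x := by simp [N_eq]

/-- Cyclic symmetry of the trace of a triple product. With `bil_mul` and `bil_conj_mul` it brings
every such trace to the form `tri x z y`, which makes up for the missing associativity. -/
lemma bil_mul_conj : bil (mul y (conj z)) x = tri x z y := by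
  simp only [tri, tr, bil_eq, mul_apply_zero, mul_apply_one, mul_apply_two, mul_apply_three,
    mul_apply_four, mul_apply_five, mul_apply_six, mul_apply_seven, conj_zero_apply,
    conj_one_apply, conj_two_apply, conj_three_apply, conj_four_apply, conj_five_apply,
    conj_six_apply, conj_seven_apply]
  ring
lemma bil_mul : bil (mul x z) y = tri x z y := rfl
lemma bil_conj_mul : bil (mul (conj x) y) z = tri x z y := by
  simp only [tri, tr, bil_eq, mul_apply_zero, mul_apply_one, mul_apply_two, mul_apply_three,
    mul_apply_four, mul_apply_five, mul_apply_six, mul_apply_seven, conj_zero_apply,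
    conj_one_apply, conj_two_apply, conj_three_apply, conj_four_apply, conj_five_apply,
    conj_six_apply, conj_seven_apply]
  ring

lemma tri_add₁ : tri (x + w) z y = tri x z y + tri w z y := by
  rw [← bil_mul, add_mul', bil_add_left]; rfl
lemma tri_add₂ : tri x (z + w) y = tri x z y + tri x w y := by
  rw [← bil_mul, mul_add', bil_add_left]; rfl
lemma tri_add₃ : tri x z (y + w) = tri x z y + tri x z w := by
  rw [← bil_mul, bil_add_right]; rfl
lemma tri_smul₁ : tri (r • x) z y = r * tri x z y := by
  rw [← bil_mul, mul_smul_left, bil_smul_left]; rfl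
lemma tri_smul₂ : tri x (r • z) y = r * tri x z y := by
  rw [← bil_mul, mul_smul_right, bil_smul_left]; rfl
lemma tri_smul₃ : tri x z (r • y) = r * tri x z y := by
  rw [← bil_mul, bil_smul_right]; rfl
@[simp] lemma tri_zero₃ : tri x z 0 = 0 := by simp [← bil_mul]

/-- Exchanging the first two rows and columns does not change the trilinear form. -/
lemma tri_conj₁ : tri (conj x) y z = tri x z y := by
  rw [← bil_mul, bil_conj_mul]

lemma tri_conj₂ : tri y (conj z) x = tri x z y := by
  rw [← bil_mul, bil_mul_conj]

lemma N_mul : N (mul x y) = N x * N y := by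
  simp only [N_eq, mul_apply_zero, mul_apply_one, mul_apply_two, mul_apply_three,
    mul_apply_four, mul_apply_five, mul_apply_six, mul_apply_seven]
  ring

lemma mul_mul_conj : mul (mul x y) (conj y) = N y • x := by
  apply ext8 <;> simp only [N_eq, mul_apply_zero, mul_apply_one, mul_apply_two, mul_apply_three,
    mul_apply_four, mul_apply_five, mul_apply_six, mul_apply_seven, conj_zero_apply,
    conj_one_apply, conj_two_apply, conj_three_apply, conj_four_apply, conj_five_apply,
    conj_six_apply, conj_seven_apply, Pi.smul_apply, smul_eq_mul] <;> ring

lemma conj_mul_mul : mul (conj x) (mul x y) = N x • y := by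
  apply ext8 <;> simp only [N_eq, mul_apply_zero, mul_apply_one, mul_apply_two, mul_apply_three,
    mul_apply_four, mul_apply_five, mul_apply_six, mul_apply_seven, conj_zero_apply,
    conj_one_apply, conj_two_apply, conj_three_apply, conj_four_apply, conj_five_apply,
    conj_six_apply, conj_seven_apply, Pi.smul_apply, smul_eq_mul] <;> ring

lemma mul_conj_mul : mul (mul x (conj y)) y = N y • x := by
  simpa using mul_mul_conj x (conj y)

lemma mul_mul_conj_left : mul x (mul (conj x) y) = N x • y := by
  simpa using conj_mul_mul (conj x) y

/-- The middle Moufang identity, written with the trilinear form. -/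
lemma moufang : mul (mul x z) (mul (conj y) x) = tri x z y • x - N x • mul y (conj z) := by
  apply ext8 <;> simp only [tri, tr, N_eq, mul_apply_zero, mul_apply_one, mul_apply_two,
    mul_apply_three, mul_apply_four, mul_apply_five, mul_apply_six, mul_apply_seven,
    conj_zero_apply, conj_one_apply, conj_two_apply, conj_three_apply, conj_four_apply,
    conj_five_apply, conj_six_apply, conj_seven_apply, Pi.smul_apply, Pi.sub_apply,
    smul_eq_mul] <;> ring

end Linear

end Oct

end ExcDomain

end

noncomputable section

namespace ExcDomain

/-! ### The cubic norm structure on Hermitian octonionic matrices -/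

namespace J

open Oct

section Access
variable {R : Type*} [CommRing R] (X Y : J R) (r : R)

lemma ext6 {S : Type*} {X Y : J S} (ha : X.a = Y.a) (hb : X.b = Y.b) (hc : X.c = Y.c)
    (hx : X.x = Y.x) (hy : X.y = Y.y) (hz : X.z = Y.z) : X = Y := by
  obtain ⟨a, b, c, x, y, z⟩ := X
  obtain ⟨a', b', c', x', y', z'⟩ := Y
  simp only [J.a, J.b, J.c, J.x, J.y, J.z] at ha hb hc hx hy hz
  subst ha hb hc hx hy hz
  rfl

section Mk
variable {S : Type*} (p q r : S) (u v w : Oct S)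
@[simp] lemma a_mk : J.a (p, q, r, u, v, w) = p := rfl
@[simp] lemma b_mk : J.b (p, q, r, u, v, w) = q := rfl
@[simp] lemma c_mk : J.c (p, q, r, u, v, w) = r := rfl
@[simp] lemma x_mk : J.x (p, q, r, u, v, w) = u := rfl
@[simp] lemma y_mk : J.y (p, q, r, u, v, w) = v := rfl
@[simp] lemma z_mk : J.z (p, q, r, u, v, w) = w := rfl
end Mk

@[simp] lemma a_add : (X + Y).a = X.a + Y.a := rfl
@[simp] lemma b_add : (X + Y).b = X.b + Y.b := rfl
@[simp] lemma c_add : (X + Y).c = X.c + Y.c := rfl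
@[simp] lemma x_add : (X + Y).x = X.x + Y.x := rfl
@[simp] lemma y_add : (X + Y).y = X.y + Y.y := rfl
@[simp] lemma z_add : (X + Y).z = X.z + Y.z := rfl
@[simp] lemma a_neg : (-X).a = -X.a := rfl
@[simp] lemma b_neg : (-X).b = -X.b := rfl
@[simp] lemma c_neg : (-X).c = -X.c := rfl
@[simp] lemma x_neg : (-X).x = -X.x := rfl
@[simp] lemma y_neg : (-X).y = -X.y := rfl
@[simp] lemma z_neg : (-X).z = -X.z := rfl
@[simp] lemma a_smul : (r • X).a = r * X.a := rfl
@[simp] lemma b_smul : (r • X).b = r * X.b := rfl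
@[simp] lemma c_smul : (r • X).c = r * X.c := rfl
@[simp] lemma x_smul : (r • X).x = r • X.x := rfl
@[simp] lemma y_smul : (r • X).y = r • X.y := rfl
@[simp] lemma z_smul : (r • X).z = r • X.z := rfl
@[simp] lemma a_zero : (0 : J R).a = 0 := rfl
@[simp] lemma b_zero : (0 : J R).b = 0 := rfl
@[simp] lemma c_zero : (0 : J R).c = 0 := rfl
@[simp] lemma x_zero : (0 : J R).x = 0 := rfl
@[simp] lemma y_zero : (0 : J R).y = 0 := rfl
@[simp] lemma z_zero : (0 : J R).z = 0 := rfl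
@[simp] lemma a_one : (one R).a = 1 := rfl
@[simp] lemma b_one : (one R).b = 1 := rfl
@[simp] lemma c_one : (one R).c = 1 := rfl
@[simp] lemma x_one : (one R).x = 0 := rfl
@[simp] lemma y_one : (one R).y = 0 := rfl
@[simp] lemma z_one : (one R).z = 0 := rfl

end Access

variable {R : Type*} [CommRing R]

/-- The linearization `X × Y + Y × X` of the product `X × X`. -/
def cross (X Y : J R) : J R :=
  (X.b * Y.c + Y.b * X.c - bil X.z Y.z, X.a * Y.c + Y.a * X.c - bil X.y Y.y,
    X.a * Y.b + Y.a * X.b - bil X.x Y.x,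
    mul X.y (conj Y.z) + mul Y.y (conj X.z) - X.c • Y.x - Y.c • X.x,
    mul X.x Y.z + mul Y.x X.z - X.b • Y.y - Y.b • X.y,
    mul (conj X.x) Y.y + mul (conj Y.x) X.y - X.a • Y.z - Y.a • X.z)

lemma pairing_eq (X Y : J R) : pairing X Y = X.a * Y.a + X.b * Y.b + X.c * Y.c
    + bil X.x Y.x + bil X.y Y.y + bil X.z Y.z := rfl

lemma det_eq (X : J R) : det X = X.a * X.b * X.c - X.a * N X.z - X.b * N X.y - X.c * N X.x
    + tri X.x X.z X.y := rfl

variable (X Y Z : J R) (r : R)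

lemma pairing_comm : pairing X Y = pairing Y X := by
  simp only [pairing_eq, bil_comm X.x, bil_comm X.y, bil_comm X.z]; ring
lemma pairing_add_left : pairing (X + Y) Z = pairing X Z + pairing Y Z := by
  simp only [pairing_eq, a_add, b_add, c_add, x_add, y_add, z_add, bil_add_left]; ring
lemma pairing_smul_left : pairing (r • X) Y = r * pairing X Y := by
  simp only [pairing_eq, a_smul, b_smul, c_smul, x_smul, y_smul, z_smul, bil_smul_left]; ring
lemma pairing_add_right : pairing X (Y + Z) = pairing X Y + pairing X Z := by
  rw [pairing_comm, pairing_add_left, pairing_comm Y, pairing_comm Z]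
lemma pairing_smul_right : pairing X (r • Y) = r * pairing X Y := by
  rw [pairing_comm, pairing_smul_left, pairing_comm Y]
@[simp] lemma pairing_neg_right : pairing X (-Y) = -pairing X Y := by
  simpa using pairing_smul_right X Y (-1)

lemma sharp_add : sharp (X + Y) = sharp X + cross X Y + sharp Y := by
  apply ext6 <;> simp only [sharp, cross, a_add, b_add, c_add, x_add, y_add, z_add, a_mk, b_mk,
    c_mk, x_mk, y_mk, z_mk, N_add, conj_add, add_mul', mul_add']
  · ring
  · ring
  · ring
  all_goals module

lemma sharp_smul : sharp (r • X) = r ^ 2 • sharp X := by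
  apply ext6 <;> simp only [sharp, a_smul, b_smul, c_smul, x_smul, y_smul, z_smul, a_mk, b_mk,
    c_mk, x_mk, y_mk, z_mk, N_smul, conj_smul, mul_smul_left, mul_smul_right]
  · ring
  · ring
  · ring
  all_goals module

lemma cross_comm : cross X Y = cross Y X := by
  apply ext6 <;> simp only [cross, a_mk, b_mk, c_mk, x_mk, y_mk, z_mk, bil_comm X.x,
    bil_comm X.y, bil_comm X.z]
  · ring
  · ring
  · ring
  all_goals module

lemma cross_add_left : cross (X + Y) Z = cross X Z + cross Y Z := by
  apply ext6 <;> simp only [cross, a_add, b_add, c_add, x_add, y_add, z_add, a_mk, b_mk,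
    c_mk, x_mk, y_mk, z_mk, bil_add_left, conj_add, add_mul', mul_add']
  · ring
  · ring
  · ring
  all_goals module

lemma cross_smul_left : cross (r • X) Y = r • cross X Y := by
  apply ext6 <;> simp only [cross, a_smul, b_smul, c_smul, x_smul, y_smul, z_smul, a_mk, b_mk,
    c_mk, x_mk, y_mk, z_mk, bil_smul_left, conj_smul, mul_smul_left, mul_smul_right]
  · ring
  · ring
  · ring
  all_goals module

lemma cross_smul_right : cross X (r • Y) = r • cross X Y := by
  rw [cross_comm, cross_smul_left, cross_comm]

@[simp] lemma cross_neg_right : cross X (-Y) = -cross X Y := by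
  simpa using cross_smul_right X Y (-1)

@[simp] lemma sharp_neg : sharp (-X) = sharp X := by
  simpa using sharp_smul X (-1)

lemma det_smul : det (r • X) = r ^ 3 * det X := by
  simp only [det_eq, a_smul, b_smul, c_smul, x_smul, y_smul, z_smul, N_smul, tri_smul₁, tri_smul₂,
    tri_smul₃]
  ring

@[simp] lemma det_neg : det (-X) = -det X := by
  have := det_smul X (-1)
  simp only [neg_smul, one_smul] at this
  rw [this]; ring

lemma cross_self : cross X X = (2 : R) • sharp X := by
  apply ext6 <;> simp only [cross, sharp, a_smul, b_smul, c_smul, x_smul, y_smul, z_smul, a_mk,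
    b_mk, c_mk, x_mk, y_mk, z_mk, bil_self]
  · ring
  · ring
  · ring
  all_goals module

/-- Both sides are the full polarization of the cubic form `det`, hence symmetric in the three
arguments. -/
lemma pairing_cross_rotate : pairing (cross X Y) Z = pairing X (cross Y Z) := by
  simp only [pairing_eq, cross, a_mk, b_mk, c_mk, x_mk, y_mk, z_mk, bil_add_left, bil_sub_left,
    bil_smul_left, bil_add_right, bil_sub_right, bil_smul_right, bil_mul,
    tri_conj₁, tri_conj₂, bil_comm _ (mul _ _)]
  ring

lemma det_add : det (X + Y) = det X + pairing (sharp X) Y + pairing X (sharp Y) + det Y := by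
  simp only [det_eq, pairing_eq, sharp, a_mk, b_mk, c_mk, x_mk, y_mk, z_mk, a_add, b_add, c_add,
    x_add, y_add, z_add, N_add, tri_add₁, tri_add₂, tri_add₃, bil_sub_left, bil_smul_left,
    bil_sub_right, bil_smul_right, bil_mul, tri_conj₁, tri_conj₂, bil_comm _ (mul _ _)]
  ring

lemma pairing_sharp_self : pairing (sharp X) X = 3 * det X := by
  simp only [det_eq, pairing_eq, sharp, a_mk, b_mk, c_mk, x_mk, y_mk, z_mk, bil_sub_left,
    bil_smul_left, bil_mul, tri_conj₁, tri_conj₂, bil_self]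
  ring

/-- The adjoint identity. The diagonal entries follow from multiplicativity of the norm; each
off-diagonal entry is the middle Moufang identity for one arrangement of the three octonions,
together with the cancellation laws such as `(x y) ȳ = N(y) x`. -/
lemma sharp_sharp : sharp (sharp X) = det X • X := by
  have m1 := moufang X.x X.y X.z
  have m2 := moufang X.y X.x (conj X.z)
  have m3 := moufang X.z (conj X.x) (conj X.y)
  simp only [conj_conj, tri_conj₁, tri_conj₂] at m1 m2 m3
  apply ext6 <;> simp only [sharp, det_eq, a_smul, b_smul, c_smul, x_smul, y_smul, z_smul, a_mk,
    b_mk, c_mk, x_mk, y_mk, z_mk, N_sub, N_mul, N_conj, N_smul, bil_smul_right, bil_mul, tri_conj₁, tri_conj₂, conj_sub, conj_of_mul, conj_conj, conj_smul, sub_mul', mul_sub', mul_smul_left,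
    mul_smul_right, mul_mul_conj, conj_mul_mul, mul_conj_mul, mul_mul_conj_left]
  · ring
  · ring
  · ring
  · rw [m1]; module
  · rw [m2]; module
  · rw [m3]; module

end J

end ExcDomain

end

noncomputable section

namespace ExcDomain

/-! ### The lattice of integral octonions in coordinates -/

namespace Oct

section Coordinates
variable {K : Type*} [Field K]

/-- The linear combination of the basis of the integral octonions with coefficients `c`. -/
def ofCoeffs (c : Fin 8 → K) : Oct K := ∑ i, c i • basis K i

/-- The coefficients of an octonion in the basis of the integral octonions. -/
def coeffs (x : Oct K) : Fin 8 → K :=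
  ![x 0 + x 5 + x 6 + x 7, x 1 - x 3 + x 5 - x 6, x 2 - x 3 + x 6 - x 7, x 3 - x 5 + x 7 - x 4,
    2 * x 3, 2 * x 5, 2 * x 6, 2 * x 7]

section Apply
variable (c : Fin 8 → K)
lemma ofCoeffs_zero : ofCoeffs c 0 = c 0 - c 5 / 2 - c 6 / 2 - c 7 / 2 := by
  simp [ofCoeffs, basis, Fin.sum_univ_eight]; ring
lemma ofCoeffs_one : ofCoeffs c 1 = c 1 + c 4 / 2 - c 5 / 2 + c 6 / 2 := by
  simp [ofCoeffs, basis, Fin.sum_univ_eight]; ring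
lemma ofCoeffs_two : ofCoeffs c 2 = c 2 + c 4 / 2 - c 6 / 2 + c 7 / 2 := by
  simp [ofCoeffs, basis, Fin.sum_univ_eight]; ring
lemma ofCoeffs_three : ofCoeffs c 3 = c 4 / 2 := by
  simp [ofCoeffs, basis, Fin.sum_univ_eight]; ring
lemma ofCoeffs_four : ofCoeffs c 4 = -c 3 + c 4 / 2 - c 5 / 2 + c 7 / 2 := by
  simp [ofCoeffs, basis, Fin.sum_univ_eight]; ring
lemma ofCoeffs_five : ofCoeffs c 5 = c 5 / 2 := by
  simp [ofCoeffs, basis, Fin.sum_univ_eight]; ring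
lemma ofCoeffs_six : ofCoeffs c 6 = c 6 / 2 := by
  simp [ofCoeffs, basis, Fin.sum_univ_eight]; ring
lemma ofCoeffs_seven : ofCoeffs c 7 = c 7 / 2 := by
  simp [ofCoeffs, basis, Fin.sum_univ_eight]; ring
end Apply

lemma ofCoeffs_intCast_mem (n : Fin 8 → ℤ) : ofCoeffs (fun i => (n i : K)) ∈ integral K := by
  refine Submodule.sum_mem _ fun i _ => ?_
  rw [Int.cast_smul_eq_zsmul]
  exact Submodule.smul_mem _ _ (Submodule.subset_span ⟨i, rfl⟩)

lemma mem_integral_iff (x : Oct K) :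
    x ∈ integral K ↔ ∃ n : Fin 8 → ℤ, x = ofCoeffs fun i => (n i : K) := by
  refine ⟨fun h => ?_, ?_⟩
  · obtain ⟨c, rfl⟩ := (Submodule.mem_span_range_iff_exists_fun ℤ).1 h
    exact ⟨c, by simp [ofCoeffs, Int.cast_smul_eq_zsmul]⟩
  · rintro ⟨n, rfl⟩
    exact ofCoeffs_intCast_mem n

lemma basis_mem (i : Fin 8) : basis K i ∈ integral K := Submodule.subset_span ⟨i, rfl⟩

lemma intCast_smul_mem {x : Oct K} (hx : x ∈ integral K) {r : K} (hr : ∃ n : ℤ, r = n) :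
    r • x ∈ integral K := by
  obtain ⟨n, rfl⟩ := hr
  rw [Int.cast_smul_eq_zsmul]
  exact Submodule.smul_mem _ _ hx

variable [CharZero K]

lemma ofCoeffs_coeffs (x : Oct K) : ofCoeffs (coeffs x) = x := by
  apply ext8 <;> simp [ofCoeffs_zero, ofCoeffs_one, ofCoeffs_two, ofCoeffs_three, ofCoeffs_four,
    ofCoeffs_five, ofCoeffs_six, ofCoeffs_seven, coeffs] <;> ring

lemma coeffs_ofCoeffs (c : Fin 8 → K) : coeffs (ofCoeffs c) = c := by
  apply ext8 <;> simp [ofCoeffs_zero, ofCoeffs_one, ofCoeffs_two, ofCoeffs_three, ofCoeffs_four,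
    ofCoeffs_five, ofCoeffs_six, ofCoeffs_seven, coeffs] <;> ring

lemma mem_integral_of_coeffs {x : Oct K} (n : Fin 8 → ℤ) (h : ∀ i, coeffs x i = n i) :
    x ∈ integral K := by
  rw [← ofCoeffs_coeffs x, show coeffs x = fun i => (n i : K) from funext h]
  exact ofCoeffs_intCast_mem n

lemma exists_coeffs_eq {x : Oct K} (hx : x ∈ integral K) (i : Fin 8) :
    ∃ n : ℤ, coeffs x i = n := by
  obtain ⟨n, rfl⟩ := (mem_integral_iff x).1 hx
  exact ⟨n i, by rw [coeffs_ofCoeffs]⟩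

lemma conj_mem {x : Oct K} (hx : x ∈ integral K) : conj x ∈ integral K := by
  obtain ⟨c, rfl⟩ := (mem_integral_iff x).1 hx
  refine mem_integral_of_coeffs ![c 0 - c 5 - c 6 - c 7, -c 1, -c 2, -c 3, -c 4, -c 5, -c 6, -c 7]
    fun i => ?_
  fin_cases i <;> simp [ofCoeffs_zero, ofCoeffs_one, ofCoeffs_two, ofCoeffs_three, ofCoeffs_four,
    ofCoeffs_five, ofCoeffs_six, ofCoeffs_seven, coeffs] <;> ring

lemma mul_mem {x y : Oct K} (hx : x ∈ integral K) (hy : y ∈ integral K) :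
    mul x y ∈ integral K := by
  obtain ⟨c, rfl⟩ := (mem_integral_iff x).1 hx
  obtain ⟨d, rfl⟩ := (mem_integral_iff y).1 hy
  -- The entries are the coordinates of the product in the basis `αᵢ`. That they are polynomials
  -- with integer coefficients is exactly the closure of the lattice under multiplication.
  refine mem_integral_of_coeffs
    ![c 0 * d 0 - c 1 * d 1 + c 1 * d 5 - c 1 * d 6 - c 2 * d 2 + c 2 * d 6 - c 2 * d 7 - c 3 * d 3
      + c 3 * d 4 - c 3 * d 5 + c 3 * d 7 - c 4 * d 1 - c 4 * d 2 - c 4 * d 4 + c 4 * d 5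
      - c 4 * d 7 - c 5 * d 5 - c 6 * d 6 - c 7 * d 7,
      c 0 * d 1 + c 1 * d 0 - c 1 * d 5 - c 1 * d 6 - c 2 * d 3 + c 2 * d 4 + c 2 * d 7 + c 3 * d 2
      + c 3 * d 7 - c 4 * d 2 + c 5 * d 6 - c 6 * d 5 - c 7 * d 1 - c 7 * d 2 - c 7 * d 3,
      c 0 * d 2 + c 1 * d 3 - c 1 * d 4 + c 1 * d 5 + c 2 * d 0 - c 2 * d 6 - c 2 * d 7 - c 3 * d 1
      + c 3 * d 5 + c 4 * d 1 - c 5 * d 1 - c 5 * d 2 - c 5 * d 3 + c 6 * d 7 - c 7 * d 6,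
      c 0 * d 3 - c 1 * d 2 + c 1 * d 6 - c 1 * d 7 + c 2 * d 1 - c 2 * d 5 + c 2 * d 6 + c 3 * d 0
      - c 3 * d 5 - c 3 * d 6 - c 3 * d 7 + c 4 * d 6 + c 5 * d 2 - c 5 * d 6 - c 6 * d 1
      - c 6 * d 2 - c 6 * d 4 + c 6 * d 5 - c 6 * d 7 + c 7 * d 1 + c 7 * d 6,
      c 0 * d 4 - c 1 * d 7 - c 2 * d 5 - c 3 * d 6 + c 4 * d 0 - c 4 * d 5 - c 4 * d 7 + c 5 * d 2
      - c 5 * d 6 + c 5 * d 7 + c 6 * d 3 - c 6 * d 4 + c 6 * d 5 - c 6 * d 7 + c 7 * d 1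
      - c 7 * d 5 + c 7 * d 6,
      c 0 * d 5 - c 1 * d 6 + c 2 * d 4 + c 3 * d 7 - c 4 * d 2 - c 4 * d 7 + c 5 * d 0 - c 5 * d 5
      + c 6 * d 1 - c 6 * d 5 - c 7 * d 3 + c 7 * d 4 - c 7 * d 5,
      c 0 * d 6 + c 1 * d 5 - c 2 * d 7 + c 3 * d 4 - c 4 * d 3 - c 5 * d 1 - c 5 * d 6 + c 6 * d 0
      - c 6 * d 6 + c 7 * d 2 - c 7 * d 6,
      c 0 * d 7 + c 1 * d 4 + c 2 * d 6 - c 3 * d 5 - c 4 * d 1 + c 4 * d 5 + c 5 * d 3 - c 5 * d 4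
      - c 5 * d 7 - c 6 * d 2 - c 6 * d 7 + c 7 * d 0 - c 7 * d 7] fun i => ?_
  fin_cases i <;> simp [coeffs, mul_apply_zero, mul_apply_one, mul_apply_two, mul_apply_three,
    mul_apply_four, mul_apply_five, mul_apply_six, mul_apply_seven, ofCoeffs_zero, ofCoeffs_one,
    ofCoeffs_two, ofCoeffs_three, ofCoeffs_four, ofCoeffs_five, ofCoeffs_six, ofCoeffs_seven] <;>
    ring

lemma N_int {x : Oct K} (hx : x ∈ integral K) : ∃ n : ℤ, N x = n := by
  obtain ⟨c, rfl⟩ := (mem_integral_iff x).1 hx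
  -- The norm in the basis `αᵢ` is an integral quadratic form (the `E₈` form): the halves cancel.
  refine ⟨c 0 ^ 2 + c 1 ^ 2 + c 2 ^ 2 + c 3 ^ 2 + c 4 ^ 2 + c 5 ^ 2 + c 6 ^ 2 + c 7 ^ 2 + c 4 * c 1
    + c 4 * c 2 - c 4 * c 3 - c 5 * c 0 - c 5 * c 1 + c 5 * c 3 - c 5 * c 4 - c 6 * c 0 + c 6 * c 1
    - c 6 * c 2 - c 7 * c 0 + c 7 * c 2 - c 7 * c 3 + c 7 * c 4, ?_⟩
  simp only [N_eq, ofCoeffs_zero, ofCoeffs_one, ofCoeffs_two, ofCoeffs_three, ofCoeffs_four,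
    ofCoeffs_five, ofCoeffs_six, ofCoeffs_seven]
  push_cast
  ring

lemma tr_int {x : Oct K} (hx : x ∈ integral K) : ∃ n : ℤ, tr x = n := by
  obtain ⟨c, rfl⟩ := (mem_integral_iff x).1 hx
  refine ⟨2 * c 0 - c 5 - c 6 - c 7, ?_⟩
  simp only [tr, ofCoeffs_zero]
  push_cast
  ring

lemma bil_int {x y : Oct K} (hx : x ∈ integral K) (hy : y ∈ integral K) :
    ∃ n : ℤ, bil x y = n :=
  tr_int (mul_mem hx (conj_mem hy))

/-- The lattice of integral octonions is self-dual for the form `Tr(x ȳ)`. -/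
lemma exists_dual (n : Fin 8 → ℤ) : ∃ x ∈ integral K, ∀ i, bil x (basis K i) = n i := by
  -- The coefficients are the inverse Gram matrix of the `αᵢ` applied to `n`; this inverse is
  -- integral because the form is unimodular.
  refine ⟨ofCoeffs fun i => ((![2 * n 0 + n 5 + n 6 + n 7, 2 * n 1 - n 3 - n 4 + n 5 - n 6,
      2 * n 2 - n 3 - n 4 + n 6 - n 7, -n 1 - n 2 + 2 * n 3 + n 4 - n 5 + n 7,
      -n 1 - n 2 + n 3 + 2 * n 4, n 0 + n 1 - n 3 + 2 * n 5, n 0 - n 1 + n 2 + 2 * n 6,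
      n 0 - n 2 + n 3 + 2 * n 7] i : ℤ) : K), ofCoeffs_intCast_mem _, fun i => ?_⟩
  fin_cases i <;> simp [bil_eq, ofCoeffs_zero, ofCoeffs_one, ofCoeffs_two, ofCoeffs_three,
    ofCoeffs_four, ofCoeffs_five, ofCoeffs_six, ofCoeffs_seven, basis] <;> ring

end Coordinates

end Oct

lemma int_add {K : Type*} [Ring K] {r s : K} (hr : ∃ n : ℤ, r = n) (hs : ∃ n : ℤ, s = n) :
    ∃ n : ℤ, r + s = n := by
  obtain ⟨m, rfl⟩ := hr
  obtain ⟨n, rfl⟩ := hs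
  exact ⟨m + n, by push_cast; rfl⟩

lemma int_sub {K : Type*} [Ring K] {r s : K} (hr : ∃ n : ℤ, r = n) (hs : ∃ n : ℤ, s = n) :
    ∃ n : ℤ, r - s = n := by
  obtain ⟨m, rfl⟩ := hr
  obtain ⟨n, rfl⟩ := hs
  exact ⟨m - n, by push_cast; rfl⟩

lemma int_mul {K : Type*} [Ring K] {r s : K} (hr : ∃ n : ℤ, r = n) (hs : ∃ n : ℤ, s = n) :
    ∃ n : ℤ, r * s = n := by
  obtain ⟨m, rfl⟩ := hr
  obtain ⟨n, rfl⟩ := hs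
  exact ⟨m * n, by push_cast; rfl⟩

/-! ### Shears and permutations acting on the Jordan algebra -/

namespace J

open Oct

variable {R : Type*} [CommRing R]

/-- The action on Hermitian matrices of the unipotent matrix with entry `v̄` in the place
`(2,1)`. -/
def shear (v : Oct R) (X : J R) : J R :=
  (X.a, X.b + bil v X.x + X.a * N v, X.c, X.x + X.a • v, X.y, X.z + mul (conj v) X.y)

/-- The map contragredient to `shear v`. -/
def coshear (v : Oct R) (X : J R) : J R :=
  (X.a - bil v X.x + X.b * N v, X.b, X.c, X.x - X.b • v, X.y - mul v X.z, X.z)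

/-- Exchange of the first two rows and columns. -/
def swap12 (X : J R) : J R := (X.b, X.a, X.c, conj X.x, X.z, X.y)

/-- Exchange of the last two rows and columns. -/
def swap23 (X : J R) : J R := (X.a, X.c, X.b, X.y, X.x, conj X.z)

variable (v : Oct R) (X Y : J R)

@[simp] lemma swap12_swap12 : swap12 (swap12 X) = X := by
  apply ext6 <;> simp [swap12]

@[simp] lemma swap23_swap23 : swap23 (swap23 X) = X := by
  apply ext6 <;> simp [swap23]

/-- Through this conjugation the facts about `shear` (adjoint, determinant, invertibility,
integrality) carry over to `coshear` without new computation. -/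
lemma coshear_eq : coshear v X = swap12 (shear (-conj v) (swap12 X)) := by
  apply ext6 <;> simp [swap12, shear, coshear, sub_eq_add_neg]

lemma det_swap12 : det (swap12 X) = det X := by
  simp only [det_eq, swap12, a_mk, b_mk, c_mk, x_mk, y_mk, z_mk, N_conj, tri_conj₁]
  ring

lemma det_swap23 : det (swap23 X) = det X := by
  simp only [det_eq, swap23, a_mk, b_mk, c_mk, x_mk, y_mk, z_mk, N_conj, tri_conj₂]
  ring

lemma pairing_swap12 : pairing (swap12 X) (swap12 Y) = pairing X Y := by
  simp only [pairing_eq, swap12, a_mk, b_mk, c_mk, x_mk, y_mk, z_mk, bil_conj_conj]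
  ring

lemma pairing_swap23 : pairing (swap23 X) (swap23 Y) = pairing X Y := by
  simp only [pairing_eq, swap23, a_mk, b_mk, c_mk, x_mk, y_mk, z_mk, bil_conj_conj]
  ring

lemma sharp_swap12 : sharp (swap12 X) = swap12 (sharp X) := by
  apply ext6 <;> simp [sharp, swap12, mul_comm]

lemma sharp_swap23 : sharp (swap23 X) = swap23 (sharp X) := by
  apply ext6 <;> simp [sharp, swap23, mul_comm]

lemma det_shear : det (shear v X) = det X := by
  have h1 : tri X.x (mul (conj v) X.y) X.y = N X.y * bil v X.x := by
    rw [← bil_mul_conj, conj_of_mul, mul_mul_conj_left, bil_smul_left, conj_conj]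
  have h2 : tri v (mul (conj v) X.y) X.y = N v * (2 * N X.y) := by
    rw [← bil_mul, mul_mul_conj_left, bil_smul_left, bil_self]
  have h3 : bil X.z (mul (conj v) X.y) = tri v X.z X.y := by rw [bil_comm, bil_conj_mul]
  simp only [det_eq, shear, a_mk, b_mk, c_mk, x_mk, y_mk, z_mk, N_add, N_mul, N_conj, N_smul,
    tri_add₁, tri_add₂, tri_smul₁, bil_smul_right, h1, h2, h3, bil_comm X.x v]
  ring

lemma pairing_shear_coshear : pairing (shear v X) (coshear v Y) = pairing X Y := by
  simp only [pairing_eq, shear, coshear, a_mk, b_mk, c_mk, x_mk, y_mk, z_mk, bil_add_left,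
    bil_sub_right, bil_smul_left, bil_smul_right, bil_self, bil_comm _ (mul _ _),
    bil_mul]
  rw [bil_comm X.x v, tri_conj₁]
  ring

/-- The linearization of `x (x̄ y) = N(x) y`. It stands in for associativity in one off-diagonal
entry of `sharp_shear`. -/
lemma mul_conj_mul_add (x y : Oct R) :
    mul x (mul (conj v) y) + mul v (mul (conj x) y) = bil v x • y := by
  have h := mul_mul_conj_left (x + v) y
  rw [conj_add, add_mul', add_mul', mul_add', mul_add', mul_mul_conj_left, mul_mul_conj_left,
    N_add, bil_comm] at h
  linear_combination (norm := module) h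

lemma sharp_shear : sharp (shear v X) = coshear v (sharp X) := by
  have h := mul_conj_mul_add v X.x X.y
  apply ext6 <;> simp only [sharp, shear, coshear, a_mk, b_mk, c_mk, x_mk, y_mk, z_mk, N_add, N_mul,
    N_conj, N_smul, bil_smul_right, bil_sub_right, conj_add, conj_of_mul, conj_conj, conj_smul,
    add_mul', mul_add', mul_sub', mul_smul_left, mul_smul_right, mul_mul_conj_left,
    bil_comm _ (mul _ _), bil_mul, tri_conj₁, tri_conj₂]
  · ring
  · rw [bil_comm X.x v]; ring
  · module
  · linear_combination (norm := module) h
  · module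

lemma shear_neg_shear : shear (-v) (shear v X) = X := by
  apply ext6 <;> simp only [shear, a_mk, b_mk, c_mk, x_mk, y_mk, z_mk, bil_neg_left, bil_add_right,
    bil_smul_right, bil_self, N_neg, conj_neg, neg_mul']
  · ring
  · module
  · module

lemma shear_shear_neg : shear v (shear (-v) X) = X := by
  simpa using shear_neg_shear (-v) X

lemma sharp_coshear : sharp (coshear v X) = shear v (sharp X) := by
  rw [coshear_eq, sharp_swap12, sharp_shear, coshear_eq, sharp_swap12]
  simp

lemma det_coshear : det (coshear v X) = det X := by
  rw [coshear_eq, det_swap12, det_shear, det_swap12]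

lemma coshear_neg_coshear : coshear (-v) (coshear v X) = X := by
  rw [coshear_eq, coshear_eq, swap12_swap12, conj_neg, shear_neg_shear, swap12_swap12]

/-- `shear v` as a linear automorphism. -/
def shearEquiv : J R ≃ₗ[R] J R where
  toFun := shear v
  invFun := shear (-v)
  left_inv := shear_neg_shear v
  right_inv := shear_shear_neg v
  map_add' X Y := by
    apply ext6 <;> simp only [shear, a_mk, b_mk, c_mk, x_mk, y_mk, z_mk, a_add, b_add, c_add, x_add,
      y_add, z_add, bil_add_right, mul_add']
    · ring
    · module
    · module
  map_smul' r X := by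
    apply ext6 <;> simp only [shear, a_mk, b_mk, c_mk, x_mk, y_mk, z_mk, a_smul, b_smul, c_smul,
      x_smul, y_smul, z_smul, bil_smul_right, mul_smul_right, RingHom.id_apply]
    · ring
    · module
    · module

/-- `swap12` as a linear automorphism. -/
def swap12Equiv : J R ≃ₗ[R] J R where
  toFun := swap12
  invFun := swap12
  left_inv := swap12_swap12
  right_inv := swap12_swap12
  map_add' X Y := by apply ext6 <;> simp [swap12]
  map_smul' r X := by apply ext6 <;> simp [swap12]

/-- `swap23` as a linear automorphism. -/
def swap23Equiv : J R ≃ₗ[R] J R where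
  toFun := swap23
  invFun := swap23
  left_inv := swap23_swap23
  right_inv := swap23_swap23
  map_add' X Y := by apply ext6 <;> simp [swap23]
  map_smul' r X := by apply ext6 <;> simp [swap23]

/-- `coshear v` as a linear automorphism. -/
def coshearEquiv : J R ≃ₗ[R] J R :=
  (swap12Equiv.trans (shearEquiv (-conj v))).trans swap12Equiv

lemma coshearEquiv_apply : coshearEquiv v X = coshear v X := (coshear_eq v X).symm

section Integral
variable {K : Type*} [Field K] {X Y : J K} {v : Oct K}

lemma add_mem_integral (hX : X ∈ integral K) (hY : Y ∈ integral K) : X + Y ∈ integral K :=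
  ⟨int_add hX.1 hY.1, int_add hX.2.1 hY.2.1, int_add hX.2.2.1 hY.2.2.1,
    add_mem hX.2.2.2.1 hY.2.2.2.1, add_mem hX.2.2.2.2.1 hY.2.2.2.2.1,
    add_mem hX.2.2.2.2.2 hY.2.2.2.2.2⟩

lemma smul_mem_integral (hX : X ∈ integral K) {r : K} (hr : ∃ n : ℤ, r = n) :
    r • X ∈ integral K :=
  ⟨int_mul hr hX.1, int_mul hr hX.2.1, int_mul hr hX.2.2.1,
    intCast_smul_mem hX.2.2.2.1 hr, intCast_smul_mem hX.2.2.2.2.1 hr,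
    intCast_smul_mem hX.2.2.2.2.2 hr⟩

lemma neg_mem_integral (hX : X ∈ integral K) : -X ∈ integral K := by
  simpa using smul_mem_integral hX (r := -1) ⟨-1, by simp⟩

variable [CharZero K]

lemma cross_mem_integral (hX : X ∈ integral K) (hY : Y ∈ integral K) : cross X Y ∈ integral K := by
  obtain ⟨ha, hb, hc, hx, hy, hz⟩ := hX
  obtain ⟨ha', hb', hc', hx', hy', hz'⟩ := hY
  exact ⟨int_sub (int_add (int_mul hb hc') (int_mul hb' hc)) (bil_int hz hz'),
    int_sub (int_add (int_mul ha hc') (int_mul ha' hc)) (bil_int hy hy'),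
    int_sub (int_add (int_mul ha hb') (int_mul ha' hb)) (bil_int hx hx'),
    sub_mem (sub_mem (add_mem (mul_mem hy (conj_mem hz')) (mul_mem hy' (conj_mem hz)))
      (intCast_smul_mem hx' hc)) (intCast_smul_mem hx hc'),
    sub_mem (sub_mem (add_mem (mul_mem hx hz') (mul_mem hx' hz))
      (intCast_smul_mem hy' hb)) (intCast_smul_mem hy hb'),
    sub_mem (sub_mem (add_mem (mul_mem (conj_mem hx) hy') (mul_mem (conj_mem hx') hy))
      (intCast_smul_mem hz' ha)) (intCast_smul_mem hz ha')⟩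

lemma sharp_mem_integral (hX : X ∈ integral K) : sharp X ∈ integral K := by
  obtain ⟨ha, hb, hc, hx, hy, hz⟩ := hX
  exact ⟨int_sub (int_mul hb hc) (N_int hz), int_sub (int_mul ha hc) (N_int hy),
    int_sub (int_mul ha hb) (N_int hx), sub_mem (mul_mem hy (conj_mem hz)) (intCast_smul_mem hx hc),
    sub_mem (mul_mem hx hz) (intCast_smul_mem hy hb),
    sub_mem (mul_mem (conj_mem hx) hy) (intCast_smul_mem hz ha)⟩

lemma det_int (hX : X ∈ integral K) : ∃ n : ℤ, det X = n := by
  obtain ⟨ha, hb, hc, hx, hy, hz⟩ := hX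
  exact int_add (int_sub (int_sub (int_sub (int_mul (int_mul ha hb) hc) (int_mul ha (N_int hz)))
    (int_mul hb (N_int hy))) (int_mul hc (N_int hx))) (bil_int (mul_mem hx hz) hy)

lemma pairing_int (hX : X ∈ integral K) (hY : Y ∈ integral K) : ∃ n : ℤ, pairing X Y = n := by
  obtain ⟨ha, hb, hc, hx, hy, hz⟩ := hX
  obtain ⟨ha', hb', hc', hx', hy', hz'⟩ := hY
  exact int_add (int_add (int_add (int_add (int_add (int_mul ha ha') (int_mul hb hb'))
    (int_mul hc hc')) (bil_int hx hx')) (bil_int hy hy')) (bil_int hz hz')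

lemma swap12_mem_integral (hX : X ∈ integral K) : swap12 X ∈ integral K := by
  obtain ⟨ha, hb, hc, hx, hy, hz⟩ := hX
  exact ⟨hb, ha, hc, conj_mem hx, hz, hy⟩

lemma swap23_mem_integral (hX : X ∈ integral K) : swap23 X ∈ integral K := by
  obtain ⟨ha, hb, hc, hx, hy, hz⟩ := hX
  exact ⟨ha, hc, hb, hy, hx, conj_mem hz⟩

lemma swap12_mem_integral_iff : swap12 X ∈ integral K ↔ X ∈ integral K :=
  ⟨fun h => by rw [← swap12_swap12 X]; exact swap12_mem_integral h, swap12_mem_integral⟩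

lemma swap23_mem_integral_iff : swap23 X ∈ integral K ↔ X ∈ integral K :=
  ⟨fun h => by rw [← swap23_swap23 X]; exact swap23_mem_integral h, swap23_mem_integral⟩

lemma shear_mem_integral (hv : v ∈ Oct.integral K) (hX : X ∈ integral K) :
    shear v X ∈ integral K := by
  obtain ⟨ha, hb, hc, hx, hy, hz⟩ := hX
  exact ⟨ha, int_add (int_add hb (bil_int hv hx)) (int_mul ha (N_int hv)), hc,
    add_mem hx (intCast_smul_mem hv ha), hy, add_mem hz (mul_mem (conj_mem hv) hy)⟩

lemma coshear_mem_integral (hv : v ∈ Oct.integral K) (hX : X ∈ integral K) :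
    coshear v X ∈ integral K := by
  rw [coshear_eq]
  exact swap12_mem_integral (shear_mem_integral (neg_mem (conj_mem hv)) (swap12_mem_integral hX))

end Integral

end J

end ExcDomain

end

/-! ### Levi elements and translations in the arithmetic group -/

noncomputable section

namespace ExcDomain

open J

/-- The linear automorphism `(X, ξ, X', ξ') ↦ (m X, ξ, m' X', ξ')`. -/
def leviEquiv (m m' : J ℂ ≃ₗ[ℂ] J ℂ) : W ≃ₗ[ℂ] W :=
  m.prodCongr ((LinearEquiv.refl ℂ ℂ).prodCongr (m'.prodCongr (LinearEquiv.refl ℂ ℂ)))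

lemma leviEquiv_mem_Gamma {m m' : J ℂ ≃ₗ[ℂ] J ℂ}
    (hp : ∀ X Y, pairing (m X) (m' Y) = pairing X Y)
    (hs : ∀ X, sharp (m X) = m' (sharp X)) (hs' : ∀ X, sharp (m' X) = m (sharp X))
    (hd : ∀ X, det (m X) = det X) (hd' : ∀ X, det (m' X) = det X)
    (hi : ∀ X, m X ∈ J.integral ℂ ↔ X ∈ J.integral ℂ)
    (hi' : ∀ X, m' X ∈ J.integral ℂ ↔ X ∈ J.integral ℂ) :
    leviEquiv m m' ∈ Gamma := by
  refine ⟨fun w => ?_, fun w v => ?_, fun w => ?_⟩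
  · change pairing (sharp (m w.1)) (sharp (m' w.2.2.1)) - w.2.1 * det (m w.1)
      - w.2.2.2 * det (m' w.2.2.1) - (pairing (m w.1) (m' w.2.2.1) - w.2.1 * w.2.2.2) ^ 2 / 4 = _
    rw [hs, hs', hd, hd', hp, pairing_comm, hp, pairing_comm]
    rfl
  · change pairing (m w.1) (m' v.2.2.1) - pairing (m v.1) (m' w.2.2.1) + w.2.1 * v.2.2.2
      - v.2.1 * w.2.2.2 = _
    rw [hp, hp]
    rfl
  · exact and_congr (hi _) (and_congr Iff.rfl (and_congr (hi' _) Iff.rfl))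

lemma leviEquiv_toW {m m' : J ℂ ≃ₗ[ℂ] J ℂ} (hs : ∀ X, sharp (m X) = m' (sharp X))
    (hd : ∀ X, det (m X) = det X) (Z : J ℂ) : leviEquiv m m' (toW Z) = toW (m Z) := by
  simp [leviEquiv, toW, hs, hd]

/-- These elements fix the last coordinate of `toW Z`, so the automorphy factor is `1` and the
weight disappears. -/
lemma IsModularForm.comp_levi {k : ℤ} {F : J ℂ → ℂ} (hF : IsModularForm k F)
    {m m' : J ℂ ≃ₗ[ℂ] J ℂ}
    (hp : ∀ X Y, pairing (m X) (m' Y) = pairing X Y)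
    (hs : ∀ X, sharp (m X) = m' (sharp X)) (hs' : ∀ X, sharp (m' X) = m (sharp X))
    (hd : ∀ X, det (m X) = det X) (hd' : ∀ X, det (m' X) = det X)
    (hi : ∀ X, m X ∈ J.integral ℂ ↔ X ∈ J.integral ℂ)
    (hi' : ∀ X, m' X ∈ J.integral ℂ ↔ X ∈ J.integral ℂ)
    {Z : J ℂ} (hZ : Z ∈ domain) (hmZ : m Z ∈ domain) : F (m Z) = F Z := by
  have := hF.transform _ (leviEquiv_mem_Gamma hp hs hs' hd hd' hi hi') Z hZ (m Z) hmZ 1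
    (by rw [leviEquiv_toW hs hd, one_smul])
  simpa using this

/-- The translation `(X, ξ, X', ξ') ↦ (X + ξ'B, ξ + (X',B) + (X,B×B) + ξ' det B, X' + X×B + B×X
+ ξ' B×B, ξ')`, as a function. -/
def translateFun (B : J ℂ) (w : W) : W :=
  (w.1 + w.2.2.2 • B,
    w.2.1 + pairing w.2.2.1 B + pairing w.1 (sharp B) + w.2.2.2 * det B,
    w.2.2.1 + cross w.1 B + w.2.2.2 • sharp B, w.2.2.2)

lemma pairing_cross_self (X Y : J ℂ) : pairing (cross X Y) Y = 2 * pairing X (sharp Y) := by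
  rw [pairing_cross_rotate, J.cross_self, pairing_smul_right]

lemma pairing_cross_left_self (X Y : J ℂ) : pairing X (cross X Y) = 2 * pairing (sharp X) Y := by
  rw [← pairing_cross_rotate, J.cross_self, pairing_smul_left]

lemma translateFun_neg_translateFun (B : J ℂ) (w : W) :
    translateFun (-B) (translateFun B w) = w := by
  obtain ⟨X, ξ, X', ξ'⟩ := w
  refine Prod.ext ?_ (Prod.ext ?_ (Prod.ext ?_ rfl)) <;>
  simp only [translateFun, pairing_neg_right, sharp_neg, det_neg, cross_neg_right, cross_add_left,
    cross_smul_left, J.cross_self, pairing_add_left, pairing_smul_left, pairing_cross_self,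
    pairing_sharp_self, pairing_comm B]
  · module
  · ring
  · module

/-- The translation by `B` as a linear automorphism. -/
def translateEquiv (B : J ℂ) : W ≃ₗ[ℂ] W where
  toFun := translateFun B
  invFun := translateFun (-B)
  left_inv := translateFun_neg_translateFun B
  right_inv w := by simpa using translateFun_neg_translateFun (-B) w
  map_add' w v := by
    refine Prod.ext ?_ (Prod.ext ?_ (Prod.ext ?_ rfl)) <;>
    simp only [translateFun, Prod.fst_add, Prod.snd_add, pairing_add_left, cross_add_left]
    · module
    · ring
    · module
  map_smul' r w := by
    refine Prod.ext ?_ (Prod.ext ?_ (Prod.ext ?_ rfl)) <;>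
    simp only [translateFun, Prod.smul_fst, Prod.smul_snd, pairing_smul_left, cross_smul_left,
      smul_eq_mul, RingHom.id_apply]
    · module
    · ring
    · module

/-- After multiplication by `ξ'²` the quartic depends only on `ξ' X' - X × X` and `ξ'² ξ - ξ' (X,
X') + 2 det X`. Both are unchanged by translations, which avoids expanding the quartic at a
translated vector. -/
lemma sq_mul_quartic (w : W) : w.2.2.2 ^ 2 * quartic w =
    -det (w.2.2.2 • w.2.2.1 - sharp w.1)
      - (w.2.2.2 ^ 2 * w.2.1 - w.2.2.2 * pairing w.1 w.2.2.1 + 2 * det w.1) ^ 2 / 4 := by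
  have h3 : det (sharp w.1) = det w.1 ^ 2 := by
    have := pairing_sharp_self (sharp w.1)
    rw [sharp_sharp, pairing_smul_left, pairing_comm, pairing_sharp_self] at this
    linear_combination -this / 3
  simp only [quartic, sub_eq_add_neg, det_add, det_smul, sharp_smul, sharp_neg, sharp_sharp,
    pairing_smul_left, pairing_smul_right, pairing_neg_right, det_neg, h3,
    pairing_comm w.2.2.1 w.1, pairing_comm (sharp w.2.2.1)]
  ring

lemma sq_mul_quartic_translate (B : J ℂ) (w : W) :
    w.2.2.2 ^ 2 * quartic (translateFun B w) = w.2.2.2 ^ 2 * quartic w := by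
  have h := sq_mul_quartic (translateFun B w)
  have e0 : (translateFun B w).2.2.2 = w.2.2.2 := rfl
  have e1 : w.2.2.2 • (translateFun B w).2.2.1 - sharp (translateFun B w).1
      = w.2.2.2 • w.2.2.1 - sharp w.1 := by
    simp only [translateFun, sharp_add, sharp_smul, cross_smul_right]
    module
  have e2 : w.2.2.2 ^ 2 * (translateFun B w).2.1
        - w.2.2.2 * pairing (translateFun B w).1 (translateFun B w).2.2.1
        + 2 * det (translateFun B w).1
      = w.2.2.2 ^ 2 * w.2.1 - w.2.2.2 * pairing w.1 w.2.2.1 + 2 * det w.1 := by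
    simp only [translateFun, det_add, det_smul, pairing_add_left, pairing_add_right,
      pairing_smul_left, pairing_smul_right, sharp_smul, pairing_cross_left_self,
      pairing_comm B (sharp B), pairing_sharp_self, pairing_comm B (cross _ _),
      pairing_cross_self, pairing_comm B w.2.2.1]
    ring
  rw [e0] at h
  rw [sq_mul_quartic w, ← e1, ← e2, h]

lemma continuous_quartic : Continuous quartic := by
  unfold quartic
  simp only [pairing_eq, det_eq, sharp, Oct.bil_eq, Oct.tri, Oct.tr, Oct.N_eq, Oct.mul_apply_zero, Oct.mul_apply_one, Oct.mul_apply_two,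
    Oct.mul_apply_three, Oct.mul_apply_four, Oct.mul_apply_five, Oct.mul_apply_six,
    Oct.mul_apply_seven, Oct.conj_zero_apply, Oct.conj_one_apply, Oct.conj_two_apply,
    Oct.conj_three_apply, Oct.conj_four_apply, Oct.conj_five_apply, Oct.conj_six_apply,
    Oct.conj_seven_apply, Pi.sub_apply, Pi.smul_apply, smul_eq_mul, J.a, J.b, J.c, J.x, J.y, J.z]
  fun_prop

lemma quartic_translate (B : J ℂ) (w : W) : quartic (translateEquiv B w) = quartic w := by
  by_cases h0 : w.2.2.2 = 0
  -- Where `ξ' = 0` the factor `ξ'²` cannot be cancelled; invariance extends there from `ξ' = t ≠ 0`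
  -- by continuity.
  · let v : ℂ → W := fun t => w + t • (0, 0, 0, 1)
    have hv : Continuous v := by fun_prop
    have hc : Continuous fun t => quartic (translateEquiv B (v t)) - quartic (v t) :=
      (continuous_quartic.comp ((LinearMap.continuous_of_finiteDimensional
        (translateEquiv B).toLinearMap).comp hv)).sub (continuous_quartic.comp hv)
    have hz : ∀ t ∈ ({0}ᶜ : Set ℂ), quartic (translateEquiv B (v t)) - quartic (v t) = 0 := by
      intro t ht
      have h := sq_mul_quartic_translate B (v t)
      have hvt : (v t).2.2.2 = t := by simp [v, h0]
      rw [hvt] at h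
      exact sub_eq_zero.2 (mul_left_cancel₀ (pow_ne_zero 2 ht) h)
    have hall : (fun t => quartic (translateEquiv B (v t)) - quartic (v t)) = fun _ => 0 :=
      hc.ext_on (dense_compl_singleton (0 : ℂ)) continuous_const hz
    have hv0 : v 0 = w := by
      change w + (0 : ℂ) • _ = w
      rw [zero_smul, add_zero]
    have := congrFun hall 0
    simpa only [hv0, sub_eq_zero] using this
  · exact mul_left_cancel₀ (pow_ne_zero 2 h0) (sq_mul_quartic_translate B w)

lemma symp_translate (B : J ℂ) (w v : W) :
    symp (translateEquiv B w) (translateEquiv B v) = symp w v := by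
  change symp (translateFun B w) (translateFun B v) = symp w v
  have h1 : pairing w.1 (cross v.1 B) = pairing v.1 (cross w.1 B) := by
    rw [← pairing_cross_rotate, cross_comm w.1 v.1, pairing_cross_rotate]
  simp only [symp, translateFun, pairing_add_left, pairing_add_right, pairing_smul_left,
    pairing_smul_right, pairing_comm B (cross _ _), pairing_cross_self, h1,
    pairing_comm B (sharp B), pairing_sharp_self, pairing_comm B w.2.2.1, pairing_comm B v.2.2.1]
  ring

lemma translateFun_mem_latticeW {B : J ℂ} (hB : B ∈ J.integral ℂ) {w : W} (hw : w ∈ latticeW) :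
    translateFun B w ∈ latticeW := by
  obtain ⟨h1, h2, h3, h4⟩ := hw
  exact ⟨add_mem_integral h1 (smul_mem_integral hB h4),
    int_add (int_add (int_add h2 (pairing_int h3 hB)) (pairing_int h1 (sharp_mem_integral hB)))
      (int_mul h4 (det_int hB)),
    add_mem_integral (add_mem_integral h3 (cross_mem_integral h1 hB))
      (smul_mem_integral (sharp_mem_integral hB) h4), h4⟩

lemma translateEquiv_mem_Gamma {B : J ℂ} (hB : B ∈ J.integral ℂ) : translateEquiv B ∈ Gamma :=
  ⟨quartic_translate B, symp_translate B, fun w =>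
    ⟨fun h => by
      simpa [translateEquiv, translateFun_neg_translateFun] using
        translateFun_mem_latticeW (neg_mem_integral hB) h,
      translateFun_mem_latticeW hB⟩⟩

lemma translateEquiv_toW (B Z : J ℂ) : translateEquiv B (toW Z) = toW (Z + B) := by
  change translateFun B (toW Z) = _
  refine Prod.ext ?_ (Prod.ext ?_ (Prod.ext ?_ rfl)) <;> simp [translateFun, toW, det_add,
    sharp_add]

lemma IsModularForm.map_add {k : ℤ} {F : J ℂ → ℂ} (hF : IsModularForm k F) {B : J ℂ}
    (hB : B ∈ J.integral ℂ) {Z : J ℂ} (hZ : Z ∈ domain) (hZB : Z + B ∈ domain) :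
    F (Z + B) = F Z := by
  have := hF.transform _ (translateEquiv_mem_Gamma hB) Z hZ (Z + B) hZB 1
    (by rw [translateEquiv_toW, one_smul])
  simpa using this

end ExcDomain

end

noncomputable section

namespace ExcDomain

open MeasureTheory Set

/-! ### Integrals of periodic functions -/

/-- The normalised measure on `ℝ / ℤ`. -/
local instance measureSpaceUnitAddCircle : MeasureSpace UnitAddCircle := ⟨AddCircle.haarAddCircle⟩

local instance isAddHaarMeasure_unitAddCircle :
    Measure.IsAddHaarMeasure (volume : Measure UnitAddCircle) :=
  inferInstanceAs (Measure.IsAddHaarMeasure AddCircle.haarAddCircle)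

local instance isProbabilityMeasure_unitAddCircle :
    IsProbabilityMeasure (volume : Measure UnitAddCircle) :=
  inferInstanceAs (IsProbabilityMeasure AddCircle.haarAddCircle)

/-- Functions on `ℝ^ι` which are periodic under `ℤ^ι`. -/
def IsPeriodic {ι E : Type*} (G : (ι → ℝ) → E) : Prop :=
  ∀ (t : ι → ℝ) (n : ι → ℤ), G (t + fun i => (n i : ℝ)) = G t

section Torus

variable {ι : Type*}

/-- The projection of `ℝ^ι` onto the torus. -/
def toTorus (t : ι → ℝ) : UnitAddTorus ι := fun i => (t i : UnitAddCircle)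

/-- A section of the projection onto the torus. -/
def torusSection (θ : UnitAddTorus ι) : ι → ℝ := fun i => (AddCircle.equivIoc 1 0 (θ i)).1

@[simp] lemma toTorus_torusSection (θ : UnitAddTorus ι) : toTorus (torusSection θ) = θ :=
  funext fun i => (AddCircle.equivIoc 1 0).symm_apply_apply (θ i)

lemma toTorus_add (s t : ι → ℝ) : toTorus (s + t) = toTorus s + toTorus t := rfl

lemma toTorus_eq_iff {s t : ι → ℝ} :
    toTorus s = toTorus t ↔ ∃ n : ι → ℤ, s = t + fun i => (n i : ℝ) := by
  constructor
  · intro h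
    have h' : ∀ i, ∃ n : ℤ, s i = t i + n := fun i => by
      obtain ⟨n, hn⟩ := AddSubgroup.mem_zmultiples_iff.1
        (QuotientAddGroup.eq_iff_sub_mem.1 (congrFun h i))
      exact ⟨n, by simp only [zsmul_eq_mul, mul_one] at hn; linarith⟩
    choose n hn using h'
    exact ⟨n, funext hn⟩
  · rintro ⟨n, rfl⟩
    funext i
    simp [toTorus]

lemma IsPeriodic.eq_of_toTorus_eq {E : Type*} {G : (ι → ℝ) → E} (hG : IsPeriodic G)
    {s t : ι → ℝ} (h : toTorus s = toTorus t) : G s = G t := by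
  obtain ⟨n, rfl⟩ := toTorus_eq_iff.1 h
  exact hG t n

lemma isOpenQuotientMap_toTorus : IsOpenQuotientMap (toTorus (ι := ι)) :=
  IsOpenQuotientMap.piMap fun _ => QuotientAddGroup.isOpenQuotientMap_mk

lemma IsPeriodic.comp_torusSection_toTorus {E : Type*} {G : (ι → ℝ) → E} (hG : IsPeriodic G)
    (t : ι → ℝ) : G (torusSection (toTorus t)) = G t :=
  hG.eq_of_toTorus_eq (toTorus_torusSection _)

lemma IsPeriodic.continuous_comp_torusSection {E : Type*} [TopologicalSpace E] {G : (ι → ℝ) → E}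
    (hG : IsPeriodic G) (hc : Continuous G) : Continuous fun θ => G (torusSection θ) := by
  rw [isOpenQuotientMap_toTorus.isQuotientMap.continuous_iff]
  convert hc using 1
  exact funext hG.comp_torusSection_toTorus

variable [Fintype ι]

lemma IsPeriodic.integral_comp_torusSection {G : (ι → ℝ) → ℂ} (hG : IsPeriodic G) :
    ∫ θ, G (torusSection θ) = ∫ t in Icc (0 : ι → ℝ) 1, G t := by
  rw [UnitAddTorus.integral_preimage _ (0 : ι → ℝ), volume_pi,
    ← setIntegral_congr_set (Measure.univ_pi_Ioc_ae_eq_Icc (f := (0 : ι → ℝ)) (g := 1))]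
  have hset : {x : ι → ℝ | ∀ i, x i ∈ Ioc ((0 : ι → ℝ) i) ((0 : ι → ℝ) i + 1)} =
      Set.pi univ fun i => Ioc ((0 : ι → ℝ) i) ((1 : ι → ℝ) i) := by
    ext x; simp [Set.mem_pi]
  rw [hset]
  congr 1
  funext t
  exact hG.comp_torusSection_toTorus t

lemma IsPeriodic.integral_add_right {G : (ι → ℝ) → ℂ} (hG : IsPeriodic G) (v : ι → ℝ) :
    ∫ t in Icc (0 : ι → ℝ) 1, G (t + v) = ∫ t in Icc (0 : ι → ℝ) 1, G t := by
  have hv : IsPeriodic fun t => G (t + v) := fun t n => by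
    have := hG (t + v) n
    rwa [add_right_comm] at this
  rw [← hG.integral_comp_torusSection, ← hv.integral_comp_torusSection,
    ← integral_add_right_eq_self (fun θ => G (torusSection θ)) (toTorus v)]
  congr 1
  funext θ
  refine hG.eq_of_toTorus_eq ?_
  rw [toTorus_add, toTorus_torusSection, toTorus_torusSection]

/-- `L` induces a continuous surjective endomorphism of the torus, and any such endomorphism
preserves the normalized Haar measure. Hence `L` only has to map `ℤ^ι` into itself, and no
determinant is needed. -/
lemma IsPeriodic.integral_comp_linearEquiv {G : (ι → ℝ) → ℂ} (hG : IsPeriodic G)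
    (hc : Continuous G)
    (L : (ι → ℝ) ≃ₗ[ℝ] (ι → ℝ)) (hL : ∀ n : ι → ℤ, ∃ m : ι → ℤ,
      L (fun i => (n i : ℝ)) = fun i => (m i : ℝ)) :
    ∫ t in Icc (0 : ι → ℝ) 1, G (L t) = ∫ t in Icc (0 : ι → ℝ) 1, G t := by
  have hwd : ∀ {s t : ι → ℝ}, toTorus s = toTorus t → toTorus (L s) = toTorus (L t) := by
    intro s t h
    obtain ⟨n, rfl⟩ := toTorus_eq_iff.1 h
    obtain ⟨m, hm⟩ := hL n
    exact toTorus_eq_iff.2 ⟨m, by rw [map_add, hm]⟩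
  let φ : UnitAddTorus ι →+ UnitAddTorus ι := AddMonoidHom.mk'
    (fun θ => toTorus (L (torusSection θ))) fun θ η => by
      rw [← toTorus_add, ← map_add]
      exact hwd (by simp [toTorus_add])
  have hφ : ∀ t, φ (toTorus t) = toTorus (L t) := fun t => hwd (by simp)
  have hcont : Continuous φ := by
    rw [isOpenQuotientMap_toTorus.isQuotientMap.continuous_iff]
    have : φ ∘ toTorus = toTorus ∘ L := funext hφ
    rw [this]
    exact isOpenQuotientMap_toTorus.continuous.comp
      (LinearMap.continuous_of_finiteDimensional L.toLinearMap)
  have hsurj : Function.Surjective φ := fun θ =>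
    ⟨toTorus (L.symm (torusSection θ)), by rw [hφ]; simp⟩
  have hGL : IsPeriodic fun t => G (L t) := fun t n => by
    obtain ⟨m, hm⟩ := hL n
    change G (L (t + fun i => (n i : ℝ))) = _
    rw [map_add, hm, hG]
  have hmp : MeasurePreserving φ (volume : Measure (UnitAddTorus ι)) volume :=
    φ.measurePreserving hcont hsurj rfl
  have key := integral_map (μ := volume) hcont.aemeasurable
    (hG.continuous_comp_torusSection hc).aestronglyMeasurable
  rw [hmp.map_eq] at key
  rw [← hG.integral_comp_torusSection, ← hGL.integral_comp_torusSection, key]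
  congr 1
  funext θ
  refine hG.eq_of_toTorus_eq ?_
  rw [toTorus_torusSection]
  rfl

end Torus

lemma integral_integral_swap_of_continuous {X Y : Type*} [TopologicalSpace X] [MeasurableSpace X]
    [BorelSpace X] [SecondCountableTopology X] [T2Space X] [TopologicalSpace Y] [MeasurableSpace Y]
    [BorelSpace Y] [SecondCountableTopology Y] [T2Space Y]
    (μ : Measure X) (ν : Measure Y) [SFinite μ] [SFinite ν] [IsFiniteMeasureOnCompacts μ]
    [IsFiniteMeasureOnCompacts ν] {s : Set X} {t : Set Y} (hs : IsCompact s) (ht : IsCompact t)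
    {f : X → Y → ℂ} (hf : Continuous (Function.uncurry f)) :
    ∫ x in s, ∫ y in t, f x y ∂ν ∂μ = ∫ y in t, ∫ x in s, f x y ∂μ ∂ν := by
  apply integral_integral_swap
  rw [Measure.prod_restrict]
  exact hf.continuousOn.integrableOn_compact (hs.prod ht)

/-- Average the translation invariance over the segment in direction `v`. This reduces a contour
shift in many variables to one complex variable. -/
lemma IsPeriodic.integral_eq_integral_line {ι : Type*} [Fintype ι] {G : (ι → ℝ) → ℂ}
    (hG : IsPeriodic G) (hc : Continuous G) (v : ι → ℝ) :
    ∫ t in Icc (0 : ι → ℝ) 1, G t =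
      ∫ t in Icc (0 : ι → ℝ) 1, ∫ r in (0 : ℝ)..1, G (t + r • v) := by
  simp only [intervalIntegral.integral_of_le zero_le_one, ← integral_Icc_eq_integral_Ioc]
  rw [integral_integral_swap_of_continuous volume volume isCompact_Icc isCompact_Icc
    (by fun_prop)]
  simp only [hG.integral_add_right]
  simp

/-! ### Restriction of a periodic function to a subtorus -/

/-- The point of `ℝ^ι` with coordinates `u` and `s`, where `ι` is the union of two sets of
indices. -/
def combine {α β ι : Type*} (e : α ⊕ β ≃ ι) (u : α → ℝ) (s : β → ℝ) : ι → ℝ :=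
  fun i => Sum.elim u s (e.symm i)

section Slice

variable {α β ι : Type*} (e : α ⊕ β ≃ ι)

@[simp] lemma combine_inl (u : α → ℝ) (s : β → ℝ) (i : α) : combine e u s (e (Sum.inl i)) = u i := by
  simp [combine]

@[simp] lemma combine_inr (u : α → ℝ) (s : β → ℝ) (i : β) : combine e u s (e (Sum.inr i)) = s i := by
  simp [combine]

lemma continuous_combine : Continuous fun p : (α → ℝ) × (β → ℝ) => combine e p.1 p.2 := by
  refine continuous_pi fun i => ?_
  unfold combine
  rcases e.symm i with j | j <;> simp only [Sum.elim_inl, Sum.elim_inr] <;> fun_prop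

lemma IsPeriodic.combine_left {E : Type*} {G : (ι → ℝ) → E} (hG : IsPeriodic G) (s : β → ℝ) :
    IsPeriodic fun u => G (combine e u s) := fun u n => by
  change G (combine e (u + _) s) = G (combine e u s)
  rw [← hG (combine e u s) fun i => Sum.elim n (fun _ => 0) (e.symm i)]
  congr 1
  funext i
  simp only [combine, Pi.add_apply]
  rcases e.symm i with j | j <;> simp

lemma IsPeriodic.combine_right {E : Type*} {G : (ι → ℝ) → E} (hG : IsPeriodic G) (u : α → ℝ) :
    IsPeriodic fun s => G (combine e u s) := fun s n => by
  change G (combine e u (s + _)) = G (combine e u s)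
  rw [← hG (combine e u s) fun i => Sum.elim (fun _ => 0) n (e.symm i)]
  congr 1
  funext i
  simp only [combine, Pi.add_apply]
  rcases e.symm i with j | j <;> simp

variable [Fintype α] [Fintype β] [Fintype ι]

lemma integral_combine {G : (ι → ℝ) → ℂ} (hc : Continuous G) :
    ∫ t in Icc (0 : ι → ℝ) 1, G t =
      ∫ s in Icc (0 : β → ℝ) 1, ∫ u in Icc (0 : α → ℝ) 1, G (combine e u s) := by
  have hmp := (volume_measurePreserving_piCongrLeft (fun _ : ι => ℝ) e).comp
    (volume_measurePreserving_sumPiEquivProdPi_symm fun _ : α ⊕ β => ℝ)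
  have hfun : ∀ p : (α → ℝ) × (β → ℝ), (MeasurableEquiv.piCongrLeft (fun _ : ι => ℝ) e)
      ((MeasurableEquiv.sumPiEquivProdPi fun _ : α ⊕ β => ℝ).symm p) = combine e p.1 p.2 := by
    intro p
    funext i
    obtain ⟨j, rfl⟩ := e.surjective i
    rw [MeasurableEquiv.piCongrLeft_apply_apply]
    rcases j with j | j <;> simp [MeasurableEquiv.sumPiEquivProdPi]
  have hpre : ((MeasurableEquiv.piCongrLeft (fun _ : ι => ℝ) e) ∘
      (MeasurableEquiv.sumPiEquivProdPi fun _ : α ⊕ β => ℝ).symm) ⁻¹' Icc (0 : ι → ℝ) 1 =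
      Icc (0 : α → ℝ) 1 ×ˢ Icc (0 : β → ℝ) 1 := by
    have key : ∀ P : ι → Prop, (∀ i, P i) ↔
        (∀ a, P (e (Sum.inl a))) ∧ ∀ b, P (e (Sum.inr b)) := fun P => by
      rw [← e.forall_congr_right, Sum.forall]
    ext p
    simp only [mem_preimage, Function.comp_apply, hfun, mem_Icc, Pi.le_def, mem_prod, key,
      combine_inl, combine_inr, Pi.zero_apply, Pi.one_apply]
    tauto
  rw [← hmp.setIntegral_preimage_emb ((MeasurableEquiv.measurableEmbedding _).comp
    (MeasurableEquiv.measurableEmbedding _)), hpre]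
  simp only [Function.comp_apply, hfun]
  have hcc : Continuous fun p : (α → ℝ) × (β → ℝ) => G (combine e p.1 p.2) :=
    hc.comp (continuous_combine e)
  rw [Measure.volume_eq_prod, setIntegral_prod _
    (hcc.continuousOn.integrableOn_compact (isCompact_Icc.prod isCompact_Icc)),
    integral_integral_swap_of_continuous _ _ isCompact_Icc isCompact_Icc hcc]

lemma mFourier_toTorus (m : β → ℤ) (s : β → ℝ) : UnitAddTorus.mFourier (-m) (toTorus s) =
    Complex.exp (-(2 * Real.pi * Complex.I * ∑ j, (m j : ℂ) * s j)) := by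
  simp only [UnitAddTorus.mFourier, toTorus, ContinuousMap.coe_mk, fourier_coe_apply,
    ← Complex.exp_sum, Finset.mul_sum, ← Finset.sum_neg_distrib]
  congr 1
  refine Finset.sum_congr rfl fun j _ => ?_
  push_cast [Pi.neg_apply]
  ring

/-- If the Fourier coefficients of `G` with nonzero frequency in the second set of variables vanish,
then the mean of `G` over the subtorus of the first set of variables is that over the whole
torus. -/
lemma IsPeriodic.integral_slice {G : (ι → ℝ) → ℂ} (hG : IsPeriodic G) (hc : Continuous G)
    (h : ∀ m : β → ℤ, m ≠ 0 → ∫ t in Icc (0 : ι → ℝ) 1, G t *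
      Complex.exp (-(2 * Real.pi * Complex.I * ∑ j, (m j : ℂ) * t (e (Sum.inr j)))) = 0) :
    ∫ u in Icc (0 : α → ℝ) 1, G (combine e u 0) = ∫ t in Icc (0 : ι → ℝ) 1, G t := by
  -- The mean over the first variables, as a function on the second torus; its Fourier coefficients
  -- are the integrals in `h`, and its value at `0` is the left-hand side.
  let g : (β → ℝ) → ℂ := fun s => ∫ u in Icc (0 : α → ℝ) 1, G (combine e u s)
  have hg : IsPeriodic g := fun s n => by
    simp only [g, (hG.combine_right e _) s n]
  have hgc : Continuous g := continuous_parametric_integral_of_continuous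
    (f := fun s u => G (combine e u s))
    (hc.comp ((continuous_combine e).comp continuous_swap)) isCompact_Icc
  let f : C(UnitAddTorus β, ℂ) := ⟨_, hg.continuous_comp_torusSection hgc⟩
  have hf : ∀ s, f (toTorus s) = g s := hg.comp_torusSection_toTorus
  have hcoeff : ∀ m, UnitAddTorus.mFourierCoeff f m = ∫ t in Icc (0 : ι → ℝ) 1, G t *
      Complex.exp (-(2 * Real.pi * Complex.I * ∑ j, (m j : ℂ) * t (e (Sum.inr j)))) := by
    intro m
    let k : (β → ℝ) → ℂ := fun s => UnitAddTorus.mFourier (-m) (toTorus s) * g s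
    have hk : IsPeriodic k := fun s n => by
      simp only [k, hg s n]
      rw [toTorus_eq_iff.2 ⟨n, rfl⟩]
    have : UnitAddTorus.mFourierCoeff f m = ∫ θ, k (torusSection θ) := by
      simp only [UnitAddTorus.mFourierCoeff, k, toTorus_torusSection, smul_eq_mul]
      rfl
    rw [this, hk.integral_comp_torusSection, integral_combine e (by fun_prop)]
    congr 1
    funext s
    simp only [k, g, combine_inr, integral_mul_const, mFourier_toTorus, mul_comm]
  -- Only the frequency `0` survives, so the coefficients are summable and the series represents the
  -- continuous function pointwise; no decay of coefficients has to be estimated.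
  have hsum : HasSum (fun m => UnitAddTorus.mFourierCoeff f m • UnitAddTorus.mFourier m (toTorus 0))
      (f (toTorus 0)) :=
    UnitAddTorus.hasSum_mFourier_series_apply_of_summable
      (summable_of_ne_finset_zero (s := {0}) fun m hm => by
        rw [hcoeff, h m (by simpa using hm)]) _
  have := hsum.unique (hasSum_single 0 fun m hm => by rw [hcoeff, h m hm, zero_smul])
  rw [hf, hcoeff, UnitAddTorus.mFourier_zero] at this
  simpa [g] using this

end Slice

/-- The integral of a periodic holomorphic function over a horizontal period does not depend on the
height. -/
lemma integral_eq_integral_add_mul_I {H : ℂ → ℂ} {s : ℝ} (hs : 0 ≤ s)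
    (hd : DifferentiableOn ℂ H {w | 0 ≤ w.im ∧ w.im ≤ s}) (hp : ∀ w, 0 ≤ w.im → w.im ≤ s →
      H (w + 1) = H w) :
    ∫ r in (0 : ℝ)..1, H r = ∫ r in (0 : ℝ)..1, H (r + s * Complex.I) := by
  -- Cauchy's theorem on the rectangle with corners `0` and `1 + s i`; the two vertical sides cancel
  -- by periodicity.
  have h := Complex.integral_boundary_rect_eq_zero_of_differentiableOn H 0 (1 + s * Complex.I)
    (hd.mono fun w hw => by
      have := hw.2
      simpa [uIcc_of_le hs] using this)
  have hside : ∫ y in (0 : ℝ)..s, H (1 + y * Complex.I) = ∫ y in (0 : ℝ)..s, H (y * Complex.I) := by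
    refine intervalIntegral.integral_congr fun y hy => ?_
    rw [uIcc_of_le hs] at hy
    rw [add_comm (1 : ℂ), hp _ (by simpa using hy.1) (by simpa using hy.2)]
  simp [hside] at h
  exact sub_eq_zero.1 h

end ExcDomain

end

/-! ### Real points of the complexified algebra, the cone and lattice coordinates -/

noncomputable section

namespace ExcDomain

open MeasureTheory Set

namespace Oct

/-- A real octonion as a complex one. -/
def ofReal (x : Oct ℝ) : Oct ℂ := fun i => (x i : ℂ)

@[simp] lemma ofReal_apply (x : Oct ℝ) (i : Fin 8) : ofReal x i = (x i : ℂ) := rfl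

lemma ofReal_conj (x : Oct ℝ) : ofReal (conj x) = conj (ofReal x) := by
  apply ext8 <;> simp

lemma ofReal_mul (x y : Oct ℝ) : ofReal (mul x y) = mul (ofReal x) (ofReal y) := by
  apply ext8 <;> simp [mul_apply_zero, mul_apply_one, mul_apply_two, mul_apply_three,
    mul_apply_four, mul_apply_five, mul_apply_six, mul_apply_seven]

lemma ofReal_bil (x y : Oct ℝ) : ((bil x y : ℝ) : ℂ) = bil (ofReal x) (ofReal y) := by
  simp [bil_eq]

lemma ofReal_N (x : Oct ℝ) : ((N x : ℝ) : ℂ) = N (ofReal x) := by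
  simp [N_eq]

lemma ofReal_ofCoeffs (c : Fin 8 → ℝ) : ofReal (ofCoeffs c) = ofCoeffs fun i => (c i : ℂ) := by
  apply ext8 <;> simp [ofCoeffs_zero, ofCoeffs_one, ofCoeffs_two, ofCoeffs_three, ofCoeffs_four,
    ofCoeffs_five, ofCoeffs_six, ofCoeffs_seven]

lemma ofReal_mem_integral {x : Oct ℝ} (hx : x ∈ integral ℝ) : ofReal x ∈ integral ℂ := by
  obtain ⟨n, rfl⟩ := (mem_integral_iff x).1 hx
  rw [ofReal_ofCoeffs]
  simpa using ofCoeffs_intCast_mem (K := ℂ) n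

lemma N_nonneg (x : Oct ℝ) : 0 ≤ N x := Finset.sum_nonneg fun _ _ => sq_nonneg _

lemma N_eq_zero {x : Oct ℝ} (h : N x = 0) : x = 0 := by
  funext i
  have := (Finset.sum_eq_zero_iff_of_nonneg fun i _ => sq_nonneg (x i)).1 h i (Finset.mem_univ i)
  simpa using this

lemma N_pos {x : Oct ℝ} (h : x ≠ 0) : 0 < N x :=
  lt_of_le_of_ne (N_nonneg x) fun h0 => h (N_eq_zero h0.symm)

end Oct

namespace J

open Oct

/-- A real element as an element of the complexified algebra. -/
def ofReal (X : J ℝ) : J ℂ :=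
  (X.a, X.b, X.c, Oct.ofReal X.x, Oct.ofReal X.y, Oct.ofReal X.z)

lemma toComplex_eq (X Y : J ℝ) : toComplex X Y = ofReal X + Complex.I • ofReal Y := by
  apply ext6 <;> first
  | (simp [toComplex, ofReal, mul_comm]; done)
  | (funext i; simp [toComplex, ofReal, mul_comm])

lemma toComplex_zero (X : J ℝ) : toComplex X 0 = ofReal X := by
  apply ext6 <;> first
  | (simp [toComplex, ofReal]; done)
  | (funext i; simp [toComplex, ofReal])

@[simp] lemma im_toComplex (X Y : J ℝ) : im (toComplex X Y) = Y := by
  apply ext6 <;> simp [toComplex, im]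

lemma toComplex_mem_domain {X Y : J ℝ} (hY : Y ∈ posCone) : toComplex X Y ∈ domain := by
  simpa [domain] using hY

lemma toComplex_add_smul (X Y V : J ℝ) (w : ℂ) :
    toComplex X Y + w • ofReal V = toComplex (X + w.re • V) (Y + w.im • V) := by
  have key : ∀ p q v : ℝ, (p + q * Complex.I + w * v : ℂ) =
      ((p + w.re * v : ℝ) : ℂ) + ((q + w.im * v : ℝ) : ℂ) * Complex.I := by
    intro p q v
    apply Complex.ext <;> simp
  apply ext6
  · exact key _ _ _
  · exact key _ _ _
  · exact key _ _ _
  all_goals exact funext fun i => key _ _ _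

lemma ofReal_mem_integral {X : J ℝ} (hX : X ∈ integral ℝ) : ofReal X ∈ integral ℂ := by
  obtain ⟨⟨l, hl⟩, ⟨m, hm⟩, ⟨n, hn⟩, hx, hy, hz⟩ := hX
  exact ⟨⟨l, by simp [ofReal, hl]⟩, ⟨m, by simp [ofReal, hm]⟩, ⟨n, by simp [ofReal, hn]⟩,
    Oct.ofReal_mem_integral hx, Oct.ofReal_mem_integral hy, Oct.ofReal_mem_integral hz⟩

lemma ofReal_pairing (X Y : J ℝ) : ((pairing X Y : ℝ) : ℂ) = pairing (ofReal X) (ofReal Y) := by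
  simp [pairing_eq, ofReal, ofReal_bil]

lemma pairing_ofReal_toComplex (T X Y : J ℝ) :
    pairing (ofReal T) (toComplex X Y) = pairing T X + pairing T Y * Complex.I := by
  rw [toComplex_eq, pairing_add_right, pairing_smul_right, ← ofReal_pairing, ← ofReal_pairing]
  ring

lemma ofReal_swap12 (X : J ℝ) : ofReal (swap12 X) = swap12 (ofReal X) := by
  apply ext6 <;> simp [ofReal, swap12, ofReal_conj]

lemma ofReal_swap23 (X : J ℝ) : ofReal (swap23 X) = swap23 (ofReal X) := by
  apply ext6 <;> simp [ofReal, swap23, ofReal_conj]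

lemma ofReal_shear (v : Oct ℝ) (X : J ℝ) :
    ofReal (shear v X) = shear (Oct.ofReal v) (ofReal X) := by
  apply ext6 <;> simp only [ofReal, shear, a_mk, b_mk, c_mk, x_mk, y_mk, z_mk]
  · push_cast [ofReal_bil, ofReal_N]; rfl
  · funext i; simp
  · rw [← ofReal_conj, ← ofReal_mul]; funext i; simp

lemma ofReal_coshear (v : Oct ℝ) (X : J ℝ) :
    ofReal (coshear v X) = coshear (Oct.ofReal v) (ofReal X) := by
  have : Oct.ofReal (-conj v) = -conj (Oct.ofReal v) := by
    rw [← ofReal_conj]; funext i; simp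
  rw [coshear_eq, coshear_eq, ofReal_swap12, ofReal_shear, ofReal_swap12, this]

lemma map_toComplex {m : J ℝ ≃ₗ[ℝ] J ℝ} {M : J ℂ ≃ₗ[ℂ] J ℂ}
    (h : ∀ X, ofReal (m X) = M (ofReal X)) (X Y : J ℝ) :
    M (toComplex X Y) = toComplex (m X) (m Y) := by
  rw [toComplex_eq, toComplex_eq, map_add, map_smul, h, h]

/-! #### The positive cone -/

lemma one_mem_posCone : one ℝ ∈ posCone :=
  ⟨one ℝ, by simp [det_eq], by apply ext6 <;> simp [sq]⟩

lemma block_mem_posCone {a b c : ℝ} {x : Oct ℝ} (ha : 0 < a) (hx : N x < a * b) (hc : 0 < c) :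
    ((a, b, c, x, 0, 0) : J ℝ) ∈ posCone := by
  have hNx := N_nonneg x
  have hb : 0 < b := pos_of_mul_pos_right (hNx.trans_lt hx) ha.le
  -- By Cayley–Hamilton, a positive `2 × 2` matrix `M` has the square root `(M + d)/s`, where `d² =
  -- det M` and `s² = tr M + 2d`.
  set d := √(a * b - N x) with hd
  have hd0 : 0 < d := Real.sqrt_pos.2 (by linarith)
  have hd2 : d ^ 2 = a * b - N x := Real.sq_sqrt (by linarith)
  set s := √(a + b + 2 * d)
  have hs0 : 0 < s := Real.sqrt_pos.2 (by linarith)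
  have hs2 : s ^ 2 = a + b + 2 * d := Real.sq_sqrt (by linarith)
  set e := √c
  have he0 : 0 < e := Real.sqrt_pos.2 hc
  have he2 : e ^ 2 = c := Real.sq_sqrt hc.le
  refine ⟨((a + d) / s, (b + d) / s, e, s⁻¹ • x, 0, 0), ?_, ?_⟩
  · have : det (((a + d) / s, (b + d) / s, e, s⁻¹ • x, 0, 0) : J ℝ) = e * d := by
      simp only [det_eq, a_mk, b_mk, c_mk, x_mk, y_mk, z_mk, N_zero, N_smul, tri_zero₃]
      field_simp
      rw [hs2]
      linear_combination -e * hd2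
    rw [this]
    positivity
  · apply ext6 <;> simp only [sq, a_mk, b_mk, c_mk, x_mk, y_mk, z_mk, N_zero, N_smul, conj_zero,
      mul_zero', smul_zero, add_zero]
    · field_simp
      rw [hs2]
      linear_combination -hd2
    · field_simp
      rw [hs2]
      linear_combination -hd2
    · exact he2.symm
    · rw [smul_smul]
      have : ((a + d) / s + (b + d) / s) * s⁻¹ = 1 := by
        field_simp
        rw [hs2]; ring
      rw [this, one_smul]

/-- The leading `2 × 2` minor of the square of an element of nonzero determinant is positive. -/
lemma posCone_minor_pos {T : J ℝ} (hT : T ∈ posCone) : 0 < T.a * T.b - N T.x := by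
  obtain ⟨X, hX, rfl⟩ := hT
  -- This is the last diagonal entry of `(X²) × (X²) = (X × X)²`, so the minor is a sum of squares.
  have key : X.sq.a * X.sq.b - N X.sq.x =
      (sharp X).c ^ 2 + N (sharp X).y + N (sharp X).z := by
    simp only [sq, sharp, a_mk, b_mk, c_mk, x_mk, y_mk, z_mk, N_add, N_sub, N_smul, N_mul, N_conj,
      bil_smul_left, bil_smul_right, bil_mul, bil_comm X.x, tri_conj₁, tri_conj₂]
    ring
  rw [key]
  have h1 := N_nonneg (sharp X).y
  have h2 := N_nonneg (sharp X).z
  have h3 := sq_nonneg (sharp X).c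
  refine lt_of_le_of_ne (by positivity) fun h => hX ?_
  -- If the sum of squares vanishes, so does the third row of `X × X`, hence `det (X × X) = (det
  -- X)²` is zero.
  have hc : (sharp X).c = 0 := by nlinarith
  have hy : (sharp X).y = 0 := N_eq_zero (by nlinarith)
  have hz : (sharp X).z = 0 := N_eq_zero (by nlinarith)
  have hdet : det X • X = sharp (sharp X) := (sharp_sharp X).symm
  have h3' := pairing_sharp_self (sharp X)
  rw [sharp_sharp, pairing_smul_left, pairing_comm, pairing_sharp_self, det_eq (sharp X), hc, hy,
    hz] at h3'
  simp only [N_zero, tri_zero₃] at h3'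
  nlinarith [h3']

lemma sq_swap12 (X : J ℝ) : sq (swap12 X) = swap12 (sq X) := by
  apply ext6 <;> simp [sq, swap12, add_comm, add_assoc, add_left_comm]

lemma sq_swap23 (X : J ℝ) : sq (swap23 X) = swap23 (sq X) := by
  apply ext6 <;> simp [sq, swap23, add_comm, add_assoc, add_left_comm]

lemma swap12_mem_posCone {T : J ℝ} (hT : T ∈ posCone) : swap12 T ∈ posCone := by
  obtain ⟨X, hX, rfl⟩ := hT
  exact ⟨swap12 X, by rwa [det_swap12], (sq_swap12 X).symm⟩

lemma swap23_mem_posCone {T : J ℝ} (hT : T ∈ posCone) : swap23 T ∈ posCone := by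
  obtain ⟨X, hX, rfl⟩ := hT
  exact ⟨swap23 X, by rwa [det_swap23], (sq_swap23 X).symm⟩

/-! #### Coordinates -/

/-- The coordinates with respect to the basis of `𝔍(ℤ)`. -/
def coords (X : J ℝ) : Fin 3 ⊕ Fin 3 × Fin 8 → ℝ :=
  Sum.elim ![X.a, X.b, X.c]
    fun p => ![Oct.coeffs X.x, Oct.coeffs X.y, Oct.coeffs X.z] p.1 p.2

lemma ofCoords_coords (X : J ℝ) : ofCoords (coords X) = X := by
  apply ext6
  · rfl
  · rfl
  · rfl
  · exact Oct.ofCoeffs_coeffs X.x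
  · exact Oct.ofCoeffs_coeffs X.y
  · exact Oct.ofCoeffs_coeffs X.z

lemma coords_ofCoords (t : Fin 3 ⊕ Fin 3 × Fin 8 → ℝ) : coords (ofCoords t) = t := by
  have key : ∀ c : Fin 8 → ℝ, Oct.coeffs (∑ i, c i • basis ℝ i) = c := Oct.coeffs_ofCoeffs
  funext i
  rcases i with i | ⟨i, j⟩
  · fin_cases i <;> rfl
  · fin_cases i <;> simp [coords, ofCoords, key]

/-- `ofCoords` as a linear equivalence. -/
def ofCoordsEquiv : (Fin 3 ⊕ Fin 3 × Fin 8 → ℝ) ≃ₗ[ℝ] J ℝ where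
  toFun := ofCoords
  invFun := coords
  left_inv := coords_ofCoords
  right_inv := ofCoords_coords
  map_add' s t := by
    apply ext6 <;> simp [ofCoords, add_smul, Finset.sum_add_distrib]
  map_smul' r t := by
    apply ext6 <;> simp [ofCoords, Finset.smul_sum, smul_smul]

lemma ofCoords_intCast_mem (n : Fin 3 ⊕ Fin 3 × Fin 8 → ℤ) :
    ofCoords (fun i => (n i : ℝ)) ∈ integral ℝ :=
  ⟨⟨_, rfl⟩, ⟨_, rfl⟩, ⟨_, rfl⟩, Oct.ofCoeffs_intCast_mem fun j => n (Sum.inr (0, j)),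
    Oct.ofCoeffs_intCast_mem fun j => n (Sum.inr (1, j)),
    Oct.ofCoeffs_intCast_mem fun j => n (Sum.inr (2, j))⟩

lemma exists_coords_eq {X : J ℝ} (hX : X ∈ integral ℝ) :
    ∃ n : Fin 3 ⊕ Fin 3 × Fin 8 → ℤ, coords X = fun i => (n i : ℝ) := by
  obtain ⟨⟨l, hl⟩, ⟨m, hm⟩, ⟨n, hn⟩, hx, hy, hz⟩ := hX
  have : ∀ i, ∃ n : ℤ, coords X i = n := by
    rintro (i | ⟨i, j⟩)
    · fin_cases i
      exacts [⟨l, hl⟩, ⟨m, hm⟩, ⟨n, hn⟩]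
    · fin_cases i
      exacts [Oct.exists_coeffs_eq hx j, Oct.exists_coeffs_eq hy j, Oct.exists_coeffs_eq hz j]
  choose p hp using this
  exact ⟨p, funext hp⟩

end J

end ExcDomain

end

/-! ### Fourier coefficients: change of base point, invariance, trivial bound -/

noncomputable section

namespace ExcDomain

open MeasureTheory Set J

/-- The index set of the coordinates on `𝔍(ℝ)`. -/
abbrev Idx := Fin 3 ⊕ Fin 3 × Fin 8

/-- The integrand of the Fourier coefficient of `F` at `T`, on the translate `𝔍(ℝ) + iY`. -/
def fourierIntegrand (F : J ℂ → ℂ) (T Y : J ℝ) (t : Idx → ℝ) : ℂ :=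
  F (toComplex (ofCoords t) Y) *
    Complex.exp (-(2 * Real.pi * Complex.I * pairing (toComplex T 0) (toComplex (ofCoords t) Y)))

/-- The Fourier coefficient computed on `𝔍(ℝ) + iY`. -/
def fourierCoeffAt (F : J ℂ → ℂ) (T Y : J ℝ) : ℂ :=
  ∫ t in Icc (0 : Idx → ℝ) 1, fourierIntegrand F T Y t

lemma fourierCoeff_eq (F : J ℂ → ℂ) (T : J ℝ) : fourierCoeff F T = fourierCoeffAt F T (one ℝ) := rfl

lemma continuous_ofCoords : Continuous ofCoords :=
  LinearMap.continuous_of_finiteDimensional ofCoordsEquiv.toLinearMap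

lemma ofCoords_add (s t : Idx → ℝ) : ofCoords (s + t) = ofCoords s + ofCoords t :=
  map_add ofCoordsEquiv s t

lemma ofCoords_smul (r : ℝ) (t : Idx → ℝ) : ofCoords (r • t) = r • ofCoords t :=
  map_smul ofCoordsEquiv r t

lemma continuous_toComplex (Y : J ℝ) : Continuous fun X => toComplex X Y := by
  unfold toComplex J.a J.b J.c J.x J.y J.z
  fun_prop

lemma differentiable_pairing (T : J ℂ) : Differentiable ℂ fun Z => pairing T Z := by
  have : (fun Z => pairing T Z) = (LinearMap.toContinuousLinearMap
      { toFun := fun Z => pairing T Z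
        map_add' := pairing_add_right T
        map_smul' := fun r Z => pairing_smul_right T Z r } : J ℂ →L[ℂ] ℂ) := rfl
  rw [this]
  exact ContinuousLinearMap.differentiable _

lemma exp_neg_two_pi_mul_int (x : ℂ) (n : ℤ) :
    Complex.exp (-(2 * Real.pi * Complex.I * (x + n))) =
      Complex.exp (-(2 * Real.pi * Complex.I * x)) := by
  rw [show -(2 * Real.pi * Complex.I * (x + n)) =
    -(2 * Real.pi * Complex.I * x) + (-n : ℤ) * (2 * Real.pi * Complex.I) by push_cast; ring,
    Complex.exp_add, Complex.exp_int_mul_two_pi_mul_I, mul_one]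

section Modular

variable {k : ℤ} {F : J ℂ → ℂ} (hF : IsModularForm k F) {T Y : J ℝ}

include hF

lemma IsModularForm.map_toComplex_add {X V : J ℝ} (hY : Y ∈ posCone) (hV : V ∈ J.integral ℝ) :
    F (toComplex (X + V) Y) = F (toComplex X Y) := by
  have h := toComplex_add_smul X Y V 1
  simp only [one_smul, Complex.one_re, Complex.one_im, zero_smul, add_zero] at h
  rw [← h]
  exact hF.map_add (ofReal_mem_integral hV) (toComplex_mem_domain hY)
    (h ▸ toComplex_mem_domain hY)

lemma IsModularForm.continuous_comp_toComplex (hY : Y ∈ posCone) :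
    Continuous fun t => F (toComplex (ofCoords t) Y) :=
  hF.holo.continuousOn.comp_continuous ((continuous_toComplex Y).comp continuous_ofCoords)
    fun _ => toComplex_mem_domain hY

lemma IsModularForm.continuous_fourierIntegrand (T : J ℝ) (hY : Y ∈ posCone) :
    Continuous (fourierIntegrand F T Y) := by
  refine (hF.continuous_comp_toComplex hY).mul (Complex.continuous_exp.comp ?_)
  exact (continuous_const.mul ((differentiable_pairing _).continuous.comp
    ((continuous_toComplex Y).comp continuous_ofCoords))).neg

lemma IsModularForm.isPeriodic_fourierIntegrand (hT : T ∈ J.integral ℝ) (hY : Y ∈ posCone) :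
    IsPeriodic (fourierIntegrand F T Y) := fun t n => by
  obtain ⟨p, hp⟩ := pairing_int hT (ofCoords_intCast_mem n)
  simp only [fourierIntegrand, ofCoords_add, hF.map_toComplex_add hY (ofCoords_intCast_mem n),
    toComplex_zero, pairing_ofReal_toComplex, pairing_add_right, hp]
  rw [← exp_neg_two_pi_mul_int (pairing T (ofCoords t) + pairing T Y * Complex.I) p]
  congr 3
  push_cast
  ring

/-- On each complex line in direction `V` the integrand is holomorphic and has period `1`, so
Cauchy's theorem changes the height. Periodicity requires `V` to be integral: base points are moved
only along lattice directions. -/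
lemma IsModularForm.fourierCoeffAt_add_smul (hT : T ∈ J.integral ℝ) {V : J ℝ}
    (hV : V ∈ J.integral ℝ) {s : ℝ} (hs : 0 ≤ s)
    (hY : ∀ r, 0 ≤ r → r ≤ s → Y + r • V ∈ posCone) :
    fourierCoeffAt F T Y = fourierCoeffAt F T (Y + s • V) := by
  have h0 : Y ∈ posCone := by simpa using hY 0 le_rfl hs
  have h1 : Y + s • V ∈ posCone := hY s hs le_rfl
  unfold fourierCoeffAt
  rw [(hF.isPeriodic_fourierIntegrand hT h0).integral_eq_integral_line
      (hF.continuous_fourierIntegrand T h0) (coords V),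
    (hF.isPeriodic_fourierIntegrand hT h1).integral_eq_integral_line
      (hF.continuous_fourierIntegrand T h1) (coords V)]
  congr 1
  funext t
  let H : ℂ → ℂ := fun w => F (toComplex (ofCoords t) Y + w • ofReal V) *
    Complex.exp (-(2 * Real.pi * Complex.I *
      pairing (toComplex T 0) (toComplex (ofCoords t) Y + w • ofReal V)))
  have hdom : ∀ w : ℂ, 0 ≤ w.im → w.im ≤ s →
      toComplex (ofCoords t) Y + w • ofReal V ∈ domain := fun w h h' => by
    rw [toComplex_add_smul]
    exact toComplex_mem_domain (hY _ h h')
  have haff : Differentiable ℂ fun w : ℂ => toComplex (ofCoords t) Y + w • ofReal V := by fun_prop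
  have hH : DifferentiableOn ℂ H {w | 0 ≤ w.im ∧ w.im ≤ s} := by
    refine (hF.holo.comp haff.differentiableOn fun w hw => hdom w hw.1 hw.2).mul
      (DifferentiableOn.cexp ?_)
    exact (((differentiable_pairing (toComplex T 0)).comp haff).const_mul
      (2 * Real.pi * Complex.I)).neg.differentiableOn
  have hper : ∀ w : ℂ, 0 ≤ w.im → w.im ≤ s → H (w + 1) = H w := by
    intro w h h'
    obtain ⟨p, hp⟩ := pairing_int (ofReal_mem_integral hT) (ofReal_mem_integral hV)
    have hshift : toComplex (ofCoords t) Y + (w + 1) • ofReal V =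
        toComplex (ofCoords t) Y + w • ofReal V + ofReal V := by module
    simp only [H]
    rw [hshift, hF.map_add (ofReal_mem_integral hV) (hdom w h h')
      (hshift ▸ hdom (w + 1) (by simpa using h) (by simpa using h')), toComplex_zero,
      pairing_add_right _ _ (ofReal V), hp, exp_neg_two_pi_mul_int]
  have hreal : ∀ r : ℝ, H r = fourierIntegrand F T Y (t + r • coords V) := fun r => by
    simp only [H, fourierIntegrand, toComplex_add_smul, ofCoords_add, ofCoords_smul,
      ofCoords_coords, Complex.ofReal_re, Complex.ofReal_im, zero_smul, add_zero]
  have htop : ∀ r : ℝ, H (r + s * Complex.I) =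
      fourierIntegrand F T (Y + s • V) (t + r • coords V) := fun r => by
    simp only [H, fourierIntegrand, toComplex_add_smul, ofCoords_add, ofCoords_smul,
      ofCoords_coords]
    simp
  simpa only [hreal, htop] using integral_eq_integral_add_mul_I hs hH hper

/-- Substitute `X ↦ m X` on the torus. The contragredient `m'` keeps the exponential unchanged, but
the base point moves from `Y` to `m Y`. -/
lemma IsModularForm.fourierCoeffAt_map (m m' : J ℝ ≃ₗ[ℝ] J ℝ) {M : J ℂ ≃ₗ[ℂ] J ℂ}
    (hM : ∀ X, ofReal (m X) = M (ofReal X))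
    (hFM : ∀ Z ∈ domain, M Z ∈ domain → F (M Z) = F Z)
    (hp : ∀ X X', pairing (m' X) (m X') = pairing X X')
    (hm : ∀ X ∈ J.integral ℝ, m X ∈ J.integral ℝ) (hm' : ∀ X ∈ J.integral ℝ, m' X ∈ J.integral ℝ)
    (hT : T ∈ J.integral ℝ) (hY : Y ∈ posCone) (hmY : m Y ∈ posCone) :
    fourierCoeffAt F (m' T) (m Y) = fourierCoeffAt F T Y := by
  have hL : ∀ t, ofCoords ((ofCoordsEquiv.trans (m.trans ofCoordsEquiv.symm)) t)
      = m (ofCoords t) := fun t => ofCoords_coords _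
  unfold fourierCoeffAt
  rw [← (hF.isPeriodic_fourierIntegrand (hm' T hT) hmY).integral_comp_linearEquiv
    (hF.continuous_fourierIntegrand _ hmY) (ofCoordsEquiv.trans (m.trans ofCoordsEquiv.symm))
    fun n => exists_coords_eq (hm _ (ofCoords_intCast_mem n))]
  congr 1
  funext t
  simp only [fourierIntegrand, hL, toComplex_zero, pairing_ofReal_toComplex, hp]
  rw [← map_toComplex hM, hFM _ (toComplex_mem_domain hY)
    (by rw [map_toComplex hM]; exact toComplex_mem_domain hmY)]

lemma IsModularForm.fourierCoeff_swap12 (hT : T ∈ J.integral ℝ) :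
    fourierCoeff F (swap12 T) = fourierCoeff F T := by
  have h1 : swap12 (one ℝ) = one ℝ := by apply ext6 <;> simp [swap12]
  have := hF.fourierCoeffAt_map (Y := one ℝ) swap12Equiv swap12Equiv (M := swap12Equiv)
    ofReal_swap12
    (fun Z hZ hMZ => hF.comp_levi (m := swap12Equiv) (m' := swap12Equiv) pairing_swap12 sharp_swap12
      sharp_swap12 det_swap12 det_swap12
      (fun X => swap12_mem_integral_iff) (fun X => swap12_mem_integral_iff) hZ hMZ)
    pairing_swap12 (fun X => swap12_mem_integral) (fun X => swap12_mem_integral) hT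
    one_mem_posCone (swap12_mem_posCone one_mem_posCone)
  change fourierCoeffAt F (swap12 T) (swap12 (one ℝ)) = _ at this
  rwa [h1] at this

lemma IsModularForm.fourierCoeff_swap23 (hT : T ∈ J.integral ℝ) :
    fourierCoeff F (swap23 T) = fourierCoeff F T := by
  have h1 : swap23 (one ℝ) = one ℝ := by apply ext6 <;> simp [swap23]
  have := hF.fourierCoeffAt_map (Y := one ℝ) swap23Equiv swap23Equiv (M := swap23Equiv)
    ofReal_swap23
    (fun Z hZ hMZ => hF.comp_levi (m := swap23Equiv) (m' := swap23Equiv) pairing_swap23 sharp_swap23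
      sharp_swap23 det_swap23 det_swap23
      (fun X => swap23_mem_integral_iff) (fun X => swap23_mem_integral_iff) hZ hMZ)
    pairing_swap23 (fun X => swap23_mem_integral) (fun X => swap23_mem_integral) hT
    one_mem_posCone (swap23_mem_posCone one_mem_posCone)
  change fourierCoeffAt F (swap23 T) (swap23 (one ℝ)) = _ at this
  rwa [h1] at this

/-- The substitution carries the base point `1` to `coshear v 1`. The two are joined inside the cone
by two segments in integral directions: the `(1,1)` entry is raised to `1 + N(v)`, then the `(1,2)`
entry runs from `0` to `-v`. Raising the diagonal entry beforehand keeps the minor `1 + N(v) - r²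
N(v)` positive. -/
lemma IsModularForm.fourierCoeff_shear {v : Oct ℝ} (hv : v ∈ Oct.integral ℝ)
    (hT : T ∈ J.integral ℝ) : fourierCoeff F (shear v T) = fourierCoeff F T := by
  have hvC : Oct.ofReal v ∈ Oct.integral ℂ := Oct.ofReal_mem_integral hv
  have hN := Oct.N_nonneg v
  have e1 : ∀ r : ℝ, one ℝ + r • ((1, 0, 0, 0, 0, 0) : J ℝ) = ((1 + r, 1, 1, 0, 0, 0) : J ℝ) := by
    intro r; apply ext6 <;> simp
  have e2 : ∀ r : ℝ, ((1 + Oct.N v, 1, 1, 0, 0, 0) : J ℝ) + r • ((0, 0, 0, -v, 0, 0) : J ℝ) =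
      ((1 + Oct.N v, 1, 1, r • -v, 0, 0) : J ℝ) := by
    intro r; apply ext6 <;> simp
  have e3 : coshear v (one ℝ) = ((1 + Oct.N v, 1, 1, (1 : ℝ) • -v, 0, 0) : J ℝ) := by
    apply ext6 <;> simp [coshear]
  have hpos : ∀ r : ℝ, 0 ≤ r → r ≤ 1 →
      ((1 + Oct.N v, 1, 1, r • -v, 0, 0) : J ℝ) ∈ posCone := fun r h0 h1 => by
    refine block_mem_posCone (by positivity) ?_ one_pos
    rw [Oct.N_smul, Oct.N_neg]
    nlinarith [mul_le_mul_of_nonneg_right (pow_le_one₀ h0 h1 : r ^ 2 ≤ 1) hN]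
  have hmem : coshear v (one ℝ) ∈ posCone := e3 ▸ hpos 1 zero_le_one le_rfl
  have hcos : ∀ {w : Oct ℂ}, w ∈ Oct.integral ℂ → ∀ X : J ℂ,
      coshearEquiv w X ∈ J.integral ℂ ↔ X ∈ J.integral ℂ := fun hw X => by
    rw [coshearEquiv_apply]
    refine ⟨fun h => ?_, coshear_mem_integral hw⟩
    rw [← coshear_neg_coshear _ X]
    exact coshear_mem_integral (neg_mem hw) h
  have hsh : ∀ {w : Oct ℂ}, w ∈ Oct.integral ℂ → ∀ X : J ℂ,
      shearEquiv w X ∈ J.integral ℂ ↔ X ∈ J.integral ℂ := fun {w} hw X => by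
    refine ⟨fun h => ?_, shear_mem_integral hw⟩
    rw [← shear_neg_shear w X]
    exact shear_mem_integral (neg_mem hw) h
  have hmap := hF.fourierCoeffAt_map (Y := one ℝ) (coshearEquiv v) (shearEquiv v)
    (M := coshearEquiv (Oct.ofReal v))
    (fun X => by simp only [coshearEquiv_apply, ofReal_coshear])
    (fun Z hZ hMZ => hF.comp_levi (m := coshearEquiv (Oct.ofReal v))
      (m' := shearEquiv (Oct.ofReal v))
      (fun X X' => by
        rw [coshearEquiv_apply, pairing_comm, pairing_comm X]
        exact pairing_shear_coshear _ _ _)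
      (fun X => by simp only [coshearEquiv_apply]; exact sharp_coshear _ _)
      (fun X => by simp only [coshearEquiv_apply]; exact sharp_shear _ _)
      (fun X => by simp only [coshearEquiv_apply]; exact det_coshear _ _)
      (fun X => det_shear _ _) (hcos hvC) (hsh hvC) hZ hMZ)
    (fun X X' => by rw [coshearEquiv_apply]; exact pairing_shear_coshear _ _ _)
    (fun X hX => by rw [coshearEquiv_apply]; exact coshear_mem_integral hv hX)
    (fun X hX => shear_mem_integral hv hX) hT one_mem_posCone
    (by rw [coshearEquiv_apply]; exact hmem)
  rw [coshearEquiv_apply] at hmap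
  change fourierCoeffAt F (shear v T) _ = _ at hmap
  have hsT : shear v T ∈ J.integral ℝ := shear_mem_integral hv hT
  rw [fourierCoeff_eq, fourierCoeff_eq, ← hmap,
    hF.fourierCoeffAt_add_smul hsT (V := (1, 0, 0, 0, 0, 0))
      ⟨⟨1, by simp⟩, ⟨0, by simp⟩, ⟨0, by simp⟩, zero_mem _, zero_mem _, zero_mem _⟩ hN
      (fun r h0 _ => by
        rw [e1]
        exact block_mem_posCone (by positivity) (by simp; positivity) one_pos), e1,
    hF.fourierCoeffAt_add_smul hsT (V := (0, 0, 0, -v, 0, 0))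
      ⟨⟨0, by simp⟩, ⟨0, by simp⟩, ⟨0, by simp⟩, neg_mem hv, zero_mem _, zero_mem _⟩ zero_le_one
      (fun r h0 h1 => by rw [e2]; exact hpos r h0 h1), e2, e3]

/-- At the base point `1` the exponential has absolute value `e^{2π tr T}`, and `F` is bounded on
the compact box. -/
lemma IsModularForm.norm_fourierCoeff_le : ∃ C : ℝ, ∀ T : J ℝ,
    ‖fourierCoeff F T‖ ≤ C * Real.exp (2 * Real.pi * (T.a + T.b + T.c)) := by
  obtain ⟨C, hC⟩ := isCompact_Icc.exists_bound_of_continuousOn (s := Icc (0 : Idx → ℝ) 1)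
    (hF.continuous_comp_toComplex one_mem_posCone).continuousOn
  refine ⟨C, fun T => ?_⟩
  have := norm_setIntegral_le_of_norm_le_const (μ := volume) (s := Icc (0 : Idx → ℝ) 1)
    (f := fourierIntegrand F T (one ℝ)) (C := C * Real.exp (2 * Real.pi * (T.a + T.b + T.c)))
    isCompact_Icc.measure_lt_top fun t ht => by
      rw [fourierIntegrand, norm_mul, Complex.norm_exp]
      refine mul_le_mul (hC t ht) (le_of_eq ?_) (Real.exp_pos _).le
        ((norm_nonneg _).trans (hC t ht))
      congr 1
      rw [toComplex_zero, pairing_ofReal_toComplex, pairing_eq T (one ℝ)]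
      simp
  rw [fourierCoeff_eq, fourierCoeffAt]
  simpa [Real.volume_Icc_pi, measureReal_def] using this

end Modular

end ExcDomain

end

/-! ### Koecher's principle and slices of the Fourier integral -/

noncomputable section

namespace ExcDomain

open MeasureTheory Set J

section Vanishing

variable {k : ℤ} {F : J ℂ → ℂ} {T : J ℝ}

/-- Shears preserve the coefficient as well as `a` and `c`. If they can make `b` arbitrarily
negative, the bound `C e^{2π tr T}` along the orbit tends to `0`. -/
lemma IsModularForm.fourierCoeff_eq_zero_of_unbounded (hF : IsModularForm k F)
    (hT : T ∈ J.integral ℝ)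
    (h : ∀ B : ℝ, ∃ v ∈ Oct.integral ℝ, (shear v T).b ≤ B) : fourierCoeff F T = 0 := by
  obtain ⟨C, hC⟩ := hF.norm_fourierCoeff_le
  have hle : ∀ B : ℝ, ‖fourierCoeff F T‖ ≤ |C| * Real.exp B := fun B => by
    -- Chosen so that the sheared matrix has trace at most `B / (2π)`.
    obtain ⟨v, hv, hB⟩ := h (B / (2 * Real.pi) - T.a - T.c)
    rw [← hF.fourierCoeff_shear hv hT]
    refine (hC _).trans (mul_le_mul (le_abs_self C) (Real.exp_le_exp.2 ?_) (Real.exp_pos _).le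
      (abs_nonneg C))
    have h1 : (shear v T).a + (shear v T).b + (shear v T).c ≤ B / (2 * Real.pi) := by
      change T.a + _ + T.c ≤ _
      linarith
    rw [mul_comm]
    exact (le_div_iff₀ Real.two_pi_pos).1 h1
  have hlim : Filter.Tendsto (fun B => |C| * Real.exp B) Filter.atBot (nhds 0) := by
    simpa using Real.tendsto_exp_atBot.const_mul |C|
  exact norm_le_zero_iff.1 (ge_of_tendsto' hlim hle)

/-- The sheared `(2,2)` entry is `b + Tr(v x̄) + a N(v)`: unbounded below along `v = ±n e₀` if `a <
0`, and along `v = -n x` if `a = 0` and `x ≠ 0`. -/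
lemma IsModularForm.fourierCoeff_eq_zero_of_ax (hF : IsModularForm k F) (hT : T ∈ J.integral ℝ)
    (h : T.a < 0 ∨ T.a = 0 ∧ T.x ≠ 0) : fourierCoeff F T = 0 := by
  refine hF.fourierCoeff_eq_zero_of_unbounded hT fun B => ?_
  rcases h with ha | ⟨ha, hx⟩
  · obtain ⟨p, hp⟩ := hT.1
    have ha1 : T.a ≤ -1 := by
      rw [hp] at ha ⊢
      have : p < 0 := by exact_mod_cast ha
      exact_mod_cast (by omega : p ≤ -1)
    obtain ⟨n, hn⟩ := exists_nat_ge (|T.b - B| + 1)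
    have hb := le_abs_self (T.b - B)
    have hb0 := abs_nonneg (T.b - B)
    -- The sign of `r = ±n` makes the linear term nonpositive; since `a ≤ -1`, at most `b - n²`
    -- remains, and `n² ≥ n`.
    have key : ∀ r : ℝ, r ^ 2 = n ^ 2 → r * T.x 0 ≤ 0 →
        (shear (r • Oct.basis ℝ 0) T).b ≤ B := by
      intro r hr hrx
      have h1 : Oct.bil (Oct.basis ℝ 0) T.x = 2 * T.x 0 := by simp [Oct.bil_eq, Oct.basis]
      have h2 : Oct.N (Oct.basis ℝ 0) = 1 := by simp [Oct.N_eq, Oct.basis]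
      simp only [shear, b_mk, Oct.bil_smul_left, Oct.N_smul, h1, h2, hr]
      nlinarith
    rcases le_total (T.x 0) 0 with hx0 | hx0
    · exact ⟨_, Oct.intCast_smul_mem (Oct.basis_mem 0) ⟨n, by simp⟩, key n rfl
        (mul_nonpos_of_nonneg_of_nonpos n.cast_nonneg hx0)⟩
    · exact ⟨_, Oct.intCast_smul_mem (r := -(n : ℝ)) (Oct.basis_mem 0) ⟨-n, by simp⟩,
        key (-n) (by ring) (by nlinarith [n.cast_nonneg (α := ℝ)])⟩
  · have hN := Oct.N_pos hx
    obtain ⟨n, hn⟩ := exists_nat_ge ((T.b - B) / (2 * Oct.N T.x))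
    refine ⟨_, Oct.intCast_smul_mem (r := -(n : ℝ)) hT.2.2.2.1 ⟨-n, by simp⟩, ?_⟩
    rw [div_le_iff₀ (by positivity)] at hn
    simp only [shear, b_mk, Oct.bil_smul_left, Oct.bil_self, ha]
    linarith

lemma IsModularForm.fourierCoeff_eq_zero_of_bz (hF : IsModularForm k F) (hT : T ∈ J.integral ℝ)
    (h : T.b < 0 ∨ T.b = 0 ∧ T.z ≠ 0) : fourierCoeff F T = 0 := by
  have h1 := swap12_mem_integral hT
  rw [← hF.fourierCoeff_swap12 hT, ← hF.fourierCoeff_swap23 h1]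
  exact hF.fourierCoeff_eq_zero_of_ax (swap23_mem_integral h1) h

lemma conj_ne_zero {x : Oct ℝ} (hx : x ≠ 0) : Oct.conj x ≠ 0 := fun h =>
  hx (by rw [← Oct.conj_conj x, h, Oct.conj_zero])

lemma IsModularForm.fourierCoeff_eq_zero_of_cyz (hF : IsModularForm k F) (hT : T ∈ J.integral ℝ)
    (hc : T.c = 0) (h : T.y ≠ 0 ∨ T.z ≠ 0) : fourierCoeff F T = 0 := by
  have h1 := swap23_mem_integral hT
  have h2 := swap12_mem_integral h1
  rw [← hF.fourierCoeff_swap23 hT, ← hF.fourierCoeff_swap12 h1]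
  rcases h with hy | hz
  · exact hF.fourierCoeff_eq_zero_of_ax h2 (Or.inr ⟨hc, conj_ne_zero hy⟩)
  · rw [← hF.fourierCoeff_swap23 h2]
    exact hF.fourierCoeff_eq_zero_of_ax (swap23_mem_integral h2) (Or.inr ⟨hc, conj_ne_zero hz⟩)

/-- Every integral linear form in the off-diagonal coordinates comes from `𝔍(ℤ)`. -/
lemma exists_dual (n : Fin 3 × Fin 8 → ℤ) : ∃ D ∈ J.integral ℝ, D.a = 0 ∧ D.b = 0 ∧ D.c = 0 ∧
    ∀ t, pairing D (ofCoords t) = ∑ p, n p * t (Sum.inr p) := by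
  choose d hd hdn using fun i => Oct.exists_dual (K := ℝ) fun j => n (i, j)
  refine ⟨(0, 0, 0, d 0, d 1, d 2), ⟨⟨0, by simp⟩, ⟨0, by simp⟩, ⟨0, by simp⟩, hd 0, hd 1, hd 2⟩,
    rfl, rfl, rfl, fun t => ?_⟩
  have hsum : ∀ i, Oct.bil (d i) (∑ j, t (Sum.inr (i, j)) • Oct.basis ℝ j) =
      ∑ j, n (i, j) * t (Sum.inr (i, j)) := fun i => by
    simp only [Fin.sum_univ_eight, Oct.bil_add_right, Oct.bil_smul_right, hdn, mul_comm]
  simp only [pairing_eq, ofCoords, a_mk, b_mk, c_mk, x_mk, y_mk, z_mk, hsum,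
    Fintype.sum_prod_type, Fin.sum_univ_three]
  ring

/-- Multiplying the integrand at `T` by a character of frequency `-m` yields, up to a constant
factor, the integrand at `T + D`, where `D` represents the linear form `m`. The frequency conditions
of `IsPeriodic.integral_slice` thus become `A_F(T + D) = 0`. -/
lemma IsModularForm.integral_fourierIntegrand_slice (hF : IsModularForm k F)
    (hT : T ∈ J.integral ℝ) {α β : Type*} [Fintype α] [Fintype β] (e : α ⊕ β ≃ Idx)
    (q : β → Fin 3 × Fin 8) (hq : ∀ j, e (Sum.inr j) = Sum.inr (q j))
    (h : ∀ m : β → ℤ, m ≠ 0 → ∀ D ∈ J.integral ℝ, D.a = 0 → D.b = 0 → D.c = 0 →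
      (∀ t, pairing D (ofCoords t) = ∑ j, m j * t (Sum.inr (q j))) → fourierCoeff F (T + D) = 0) :
    ∫ u in Icc (0 : α → ℝ) 1, fourierIntegrand F T (one ℝ) (combine e u 0) = fourierCoeff F T := by
  classical
  refine (hF.isPeriodic_fourierIntegrand hT one_mem_posCone).integral_slice e
    (hF.continuous_fourierIntegrand T one_mem_posCone) fun m hm => ?_
  obtain ⟨D, hD, ha, hb, hc, hpair⟩ := exists_dual fun p => ∑ j, if q j = p then m j else 0
  have hpair' : ∀ t, pairing D (ofCoords t) = ∑ j, m j * t (Sum.inr (q j)) := fun t => by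
    rw [hpair]
    push_cast
    simp only [Finset.sum_mul]
    rw [Finset.sum_comm]
    refine Finset.sum_congr rfl fun j _ => ?_
    simp
  have h0 := h m hm D hD ha hb hc hpair'
  have : ∀ t, fourierIntegrand F T (one ℝ) t *
      Complex.exp (-(2 * Real.pi * Complex.I * ∑ j, (m j : ℂ) * t (e (Sum.inr j)))) =
      fourierIntegrand F (T + D) (one ℝ) t *
        Complex.exp (2 * Real.pi * Complex.I * (pairing D (one ℝ) * Complex.I)) := fun t => by
    simp only [fourierIntegrand, hq]
    rw [mul_assoc (F _), mul_assoc (F _), ← Complex.exp_add, ← Complex.exp_add]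
    congr 2
    have h1 : (∑ j, (m j : ℂ) * t (Sum.inr (q j))) = ((pairing D (ofCoords t) : ℝ) : ℂ) := by
      rw [hpair']; push_cast; rfl
    rw [h1, toComplex_zero, toComplex_zero, pairing_ofReal_toComplex, pairing_ofReal_toComplex,
      pairing_add_left, pairing_add_left]
    push_cast
    ring
  simp only [this, integral_mul_const]
  rw [fourierCoeff_eq, fourierCoeffAt] at h0
  rw [h0, zero_mul]

end Vanishing

/-! ### The cusp condition -/

section Cusp

variable {k : ℤ} {F : J ℂ → ℂ} (hF : IsCuspForm k F)

include hF

/-- The constant term of a cusp form in the last variable vanishes. -/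
lemma IsCuspForm.integral_block_eq_zero {Z : J2 ℂ} (hZ : Z ∈ domain2)
    (hblock : ∀ τ : ℂ, 0 < τ.im → block Z τ ∈ domain) {w₀ : ℂ} (hw₀ : 0 < w₀.im) :
    ∫ r in (0 : ℝ)..1, F (block Z (w₀ + r)) = 0 := by
  have hadd : ∀ τ : ℂ, block Z (τ + 1) = block Z τ + ((0, 0, 1, 0, 0, 0) : J ℂ) := fun τ => by
    apply ext6 <;> simp [block]
  have hint : ((0, 0, 1, 0, 0, 0) : J ℂ) ∈ J.integral ℂ :=
    ⟨⟨0, by simp⟩, ⟨0, by simp⟩, ⟨1, by simp⟩, zero_mem _, zero_mem _, zero_mem _⟩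
  have hdiff : Differentiable ℂ fun w : ℂ => block Z (w₀ + w) := by
    unfold block
    fun_prop
  have hpos : ∀ w : ℂ, 0 ≤ w.im → 0 < (w₀ + w).im := fun w hw => by
    rw [Complex.add_im]; linarith
  have hshift : ∀ s : ℝ, 0 ≤ s → ∫ r in (0 : ℝ)..1, F (block Z (w₀ + r)) =
      ∫ r in (0 : ℝ)..1, F (block Z (w₀ + (r + s * Complex.I))) := fun s hs =>
    integral_eq_integral_add_mul_I (H := fun w => F (block Z (w₀ + w))) hs
      (hF.holo.comp hdiff.differentiableOn fun w hw => hblock _ (hpos w hw.1))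
      fun w h h' => by
        rw [← add_assoc, hadd]
        refine hF.map_add hint (hblock _ (hpos w h)) ?_
        rw [← hadd]
        refine hblock _ ?_
        have := hpos w h
        simpa using this
  -- The mean over a horizontal period does not depend on the height. The cusp limit is uniform in
  -- `Re τ`, so at a large height the mean is at most `ε`.
  refine norm_le_zero_iff.1 (le_of_forall_pos_le_add fun ε hε => ?_)
  have hev := (Metric.tendsto_nhds.1 (hF.cusp Z hZ)) ε hε
  rw [Filter.eventually_comap, Filter.eventually_atTop] at hev
  obtain ⟨b, hb⟩ := hev
  rw [hshift (max 0 (b - w₀.im)) (le_max_left _ _), zero_add]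
  refine (intervalIntegral.norm_integral_le_of_norm_le_const (C := ε) fun r _ => ?_).trans
    (by simp)
  have := hb (w₀.im + max 0 (b - w₀.im)) (by linarith [le_max_right 0 (b - w₀.im)])
    (w₀ + (r + (max 0 (b - w₀.im) : ℝ) * Complex.I)) (by simp)
  rw [dist_zero_right] at this
  exact this.le

end Cusp

end ExcDomain

end

/-! ### Vanishing of the coefficients over `S` and of the Siegel coefficient -/

noncomputable section

namespace ExcDomain

open MeasureTheory Set J

/-- The indices of the coordinates of the upper left block and of the last diagonal entry, followed
by the other ones. -/
def cuspIndex : (Fin 3 ⊕ Fin 8) ⊕ (Fin 2 × Fin 8) → Idx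
  | Sum.inl (Sum.inl i) => Sum.inl i
  | Sum.inl (Sum.inr j) => Sum.inr (0, j)
  | Sum.inr (i, j) => Sum.inr (i.succ, j)

lemma cuspIndex_bijective : Function.Bijective cuspIndex := by
  rw [Fintype.bijective_iff_injective_and_card]
  refine ⟨?_, by simp⟩
  rintro ((i | j) | ⟨i, j⟩) ((i' | j') | ⟨i', j'⟩) h <;> simp_all [cuspIndex]
  exact Fin.succ_ne_zero _ h.1.symm

lemma eq_zero_of_sum_eq_zero {β : Type*} [Fintype β] {q : β → Fin 3 × Fin 8}
    (hq : Function.Injective q) {m : β → ℤ}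
    (h : ∀ t : Idx → ℝ, ∑ j, m j * t (Sum.inr (q j)) = 0) : m = 0 := by
  classical
  funext j
  have := h (Pi.single (Sum.inr (q j)) 1)
  simpa [Pi.single_apply, hq.eq_iff] using this

/-- Slice along the block matrices `diag(Z, τ)`. The other frequencies have `c = 0` and a nonzero
entry in the last column, so Koecher's principle removes them. On the slice the exponential does not
involve `τ` because `c = 0`, and integrating over `τ` gives the constant term of a cusp form. -/
lemma IsCuspForm.fourierCoeff_eq_zero_of_block {k : ℤ} {F : J ℂ → ℂ} (hF : IsCuspForm k F)
    {T : J ℝ} (hT : T ∈ J.integral ℝ) (hc : T.c = 0) (hy : T.y = 0) (hz : T.z = 0) :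
    fourierCoeff F T = 0 := by
  let e := Equiv.ofBijective cuspIndex cuspIndex_bijective
  let q : Fin 2 × Fin 8 → Fin 3 × Fin 8 := fun p => (p.1.succ, p.2)
  have hqinj : Function.Injective q := by
    rintro ⟨i, j⟩ ⟨i', j'⟩ h
    simpa [q] using h
  have hslice := hF.integral_fourierIntegrand_slice hT e q (fun _ => rfl)
    fun m hm D hD ha hb hc' hpair => by
      -- `D` is orthogonal to the whole `x`-block, in particular to its own entry, so `2 N(D.x) =
      -- 0`.
      have hx : D.x = 0 := by
        have h1 := hpair (coords ((0, 0, 0, D.x, 0, 0) : J ℝ))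
        rw [ofCoords_coords, pairing_eq] at h1
        have h2 : ∀ j, coords ((0, 0, 0, D.x, 0, 0) : J ℝ) (Sum.inr (q j)) = 0 := by
          rintro ⟨i, j⟩
          fin_cases i <;> fin_cases j <;> simp [coords, q, Oct.coeffs]
        simp only [h2, mul_zero, Finset.sum_const_zero, a_mk, b_mk, c_mk, x_mk, y_mk, z_mk,
          Oct.bil_zero_right, Oct.bil_self] at h1
        exact Oct.N_eq_zero (by linarith)
      refine hF.fourierCoeff_eq_zero_of_cyz (add_mem_integral hT hD) (by simp [hc, hc']) ?_
      simp only [y_add, z_add, hy, hz, zero_add]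
      by_contra! hyz
      refine hm (eq_zero_of_sum_eq_zero hqinj fun t => ?_)
      rw [← hpair t, pairing_eq, ha, hb, hc', hx, hyz.1, hyz.2]
      simp
  rw [← hslice]
  have hper := (hF.isPeriodic_fourierIntegrand hT one_mem_posCone).combine_left e 0
  have hcont : Continuous fun u => fourierIntegrand F T (one ℝ) (combine e u 0) :=
    (hF.continuous_fourierIntegrand T one_mem_posCone).comp
      ((continuous_combine e).comp (by fun_prop : Continuous fun u => (u, (0 : Fin 2 × Fin 8 → ℝ))))
  rw [hper.integral_eq_integral_line hcont (Pi.single (Sum.inl 2) 1)]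
  refine integral_eq_zero_of_ae (Filter.Eventually.of_forall fun u => ?_)
  set Z : J2 ℂ := (u (Sum.inl 0) + Complex.I, u (Sum.inl 1) + Complex.I,
    Oct.ofReal (∑ j, u (Sum.inr j) • Oct.basis ℝ j)) with hZdef
  have hZ : Z ∈ domain2 := by
    refine ⟨1, 1, 0, by simp, ?_⟩
    refine Prod.ext (by simp [Z]) (Prod.ext (by simp [Z]) ?_)
    funext i
    simp [Z]
  have hblock : ∀ τ : ℂ, 0 < τ.im → block Z τ ∈ domain := by
    intro τ hτ
    have : (block Z τ).im = (1, 1, τ.im, 0, 0, 0) := by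
      apply ext6 <;> first
      | (simp [block, J.im, Z]; done)
      | (funext i; simp [block, J.im, Z])
    rw [domain, mem_ofPred_eq, this]
    exact block_mem_posCone one_pos (by simp) hτ
  have hpt : ∀ r : ℝ, toComplex (ofCoords (combine e
      (u + r • Pi.single (Sum.inl 2) 1) 0)) (one ℝ) =
      block Z ((u (Sum.inl 2) + Complex.I) + r) := by
    intro r
    have h1 : ∀ i, combine e (u + r • Pi.single (Sum.inl 2) 1) 0 (Sum.inl i) =
        u (Sum.inl i) + r * (Pi.single (Sum.inl 2) 1 : Fin 3 ⊕ Fin 8 → ℝ) (Sum.inl i) :=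
      fun i => combine_inl e _ _ (Sum.inl i)
    have h2 : ∀ j, combine e (u + r • Pi.single (Sum.inl 2) 1) 0 (Sum.inr (0, j)) =
        u (Sum.inr j) := fun j => by
      rw [show (Sum.inr (0, j) : Idx) = e (Sum.inl (Sum.inr j)) from rfl, combine_inl]
      simp
    have h3 : ∀ j, combine e (u + r • Pi.single (Sum.inl 2) 1) 0 (Sum.inr (1, j)) = 0 :=
      fun j => combine_inr e _ _ (0, j)
    have h4 : ∀ j, combine e (u + r • Pi.single (Sum.inl 2) 1) 0 (Sum.inr (2, j)) = 0 :=
      fun j => combine_inr e _ _ (1, j)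
    apply ext6 <;> first
    | (simp [block, toComplex, ofCoords, Z, h1, h2, h3, h4]; done)
    | (simp [block, toComplex, ofCoords, Z, h1, h2, h3, h4]; ring; done)
    | (funext i; simp [block, toComplex, ofCoords, Z, h1, h2, h3, h4])
  have hexp : ∀ r : ℝ, pairing (toComplex T 0) (block Z ((u (Sum.inl 2) + Complex.I) + r)) =
      pairing (toComplex T 0) (block Z (u (Sum.inl 2) + Complex.I)) := fun r => by
    simp only [pairing_eq, block, toComplex_zero, J.ofReal, a_mk, b_mk, c_mk, x_mk, y_mk, z_mk, hc]
    simp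
  change ∫ r in (0 : ℝ)..1, fourierIntegrand F T (one ℝ)
    (combine e (u + r • Pi.single (Sum.inl 2) 1) 0) = 0
  simp only [fourierIntegrand, hpt, hexp, intervalIntegral.integral_mul_const]
  rw [hF.integral_block_eq_zero hZ hblock (by simp), zero_mul]

lemma Oct.one_le_N {x : Oct ℝ} (hx : x ∈ Oct.integral ℝ) (h0 : x 0 = 1 / 2) : 1 ≤ Oct.N x := by
  obtain ⟨n, hn⟩ := Oct.N_int hx
  have h1 : 0 < Oct.N x := Oct.N_pos fun h => by simp [h] at h0
  rw [hn] at h1 ⊢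
  have : 0 < n := by exact_mod_cast h1
  exact_mod_cast this

/-- Complete the square: since `a = 1`, the shear by `-x` clears `x` and leaves `b = 1 - N(x) ≤ 0`.
Koecher's principle applies unless `b` and `z` both become `0`; then the second row and column are
zero, and exchanging them with the third reduces to the block case. -/
lemma IsCuspForm.fourierCoeff_eq_zero {k : ℤ} {F : J ℂ → ℂ} (hF : IsCuspForm k F)
    {T : J ℝ} (hT : T ∈ J.integral ℝ) (ha : T.a = 1) (hb : T.b = 1) (hx : T.x 0 = 1 / 2) :
    fourierCoeff F T = 0 := by
  have hN := Oct.one_le_N hT.2.2.2.1 hx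
  have hxm : -T.x ∈ Oct.integral ℝ := neg_mem hT.2.2.2.1
  have hU : shear (-T.x) T ∈ J.integral ℝ := shear_mem_integral hxm hT
  rw [← hF.fourierCoeff_shear hxm hT]
  have hUb : (shear (-T.x) T).b = 1 - Oct.N T.x := by
    simp only [shear, b_mk, Oct.bil_neg_left, Oct.bil_self, Oct.N_neg, ha, hb]
    ring
  have hUx : (shear (-T.x) T).x = 0 := by
    simp [shear, ha]
  rcases lt_or_eq_of_le hN with hlt | heq
  · exact hF.fourierCoeff_eq_zero_of_bz hU (Or.inl (by rw [hUb]; linarith))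
  · have hb0 : (shear (-T.x) T).b = 0 := by rw [hUb]; linarith
    by_cases hz : (shear (-T.x) T).z = 0
    · rw [← hF.fourierCoeff_swap23 hU]
      exact hF.fourierCoeff_eq_zero_of_block (swap23_mem_integral hU) hb0 hUx
        (by simp [swap23, hz])
    · exact hF.fourierCoeff_eq_zero_of_bz hU (Or.inr ⟨hb0, hz⟩)

/-- The indices of the coordinates of the real symmetric matrices, followed by the other ones. -/
def siegelIndex : Fin 6 ⊕ (Fin 3 × Fin 7) → Idx
  | Sum.inl i => ![Sum.inl 0, Sum.inl 1, Sum.inl 2, Sum.inr (0, 0), Sum.inr (1, 0), Sum.inr (2, 0)] i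
  | Sum.inr (i, j) => Sum.inr (i, j.succ)

lemma siegelIndex_bijective : Function.Bijective siegelIndex := by
  rw [Fintype.bijective_iff_injective_and_card]
  refine ⟨?_, by simp⟩
  rintro (i | ⟨i, j⟩) (i' | ⟨i', j'⟩) h
  · fin_cases i <;> fin_cases i' <;> simp_all [siegelIndex]
  · fin_cases i <;> simp_all [siegelIndex, (Fin.succ_ne_zero _).symm]
  · fin_cases i' <;> simp_all [siegelIndex, Fin.succ_ne_zero]
  · simp_all [siegelIndex]

lemma IsCuspForm.siegelFourierCoeff_eq_zero {k : ℤ} {F : J ℂ → ℂ} (hF : IsCuspForm k F)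
    {S : Matrix (Fin 3) (Fin 3) ℝ} {a b c : ℝ} (hS : S = !![1, 1 / 2, a; 1 / 2, 1, b; a, b, c])
    (hS_mem : S ∈ halfIntegralNonneg) : siegelFourierCoeff (restrict F) S = 0 := by
  obtain ⟨-, hdiag, hhalf⟩ := hS_mem
  obtain ⟨l, hl⟩ := hhalf 0 2
  obtain ⟨m, hm⟩ := hhalf 1 2
  obtain ⟨n, hn⟩ := hdiag 2
  simp [hS] at hl hm hn
  -- Self-duality against `α₀ = e₀`, where `Tr(x ē₀) = 2 x₀`: every half-integer is the real part of
  -- an integral octonion.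
  have hdual : ∀ n : ℤ, ∃ x ∈ Oct.integral ℝ, x 0 = (n : ℝ) / 2 := fun n => by
    obtain ⟨x, hx, h⟩ := Oct.exists_dual (K := ℝ) (Pi.single 0 n)
    have := h 0
    simp [Oct.bil_eq, Oct.basis] at this
    exact ⟨x, hx, by linarith⟩
  obtain ⟨x, hx, hx0⟩ := hdual 1
  obtain ⟨y, hy, hy0⟩ := hdual l
  obtain ⟨z, hz, hz0⟩ := hdual m
  rw [Int.cast_one] at hx0
  rw [← hl] at hy0
  rw [← hm] at hz0
  -- Any integral lift of `S` serves as the reference point; it need not be semidefinite.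
  have hT : ((1, 1, c, x, y, z) : J ℝ) ∈ J.integral ℝ :=
    ⟨⟨1, by simp⟩, ⟨1, by simp⟩, ⟨n, hn⟩, hx, hy, hz⟩
  let e := Equiv.ofBijective siegelIndex siegelIndex_bijective
  let q : Fin 3 × Fin 7 → Fin 3 × Fin 8 := fun p => (p.1, p.2.succ)
  have hslice := hF.integral_fourierIntegrand_slice hT e q (fun _ => rfl)
    fun m hm D hD ha hb hc hpair => by
      -- The linear form of `D` does not involve the coordinate along `α₀ = e₀`, so `T + D` still
      -- has `Re x = 1/2` and its coefficient vanishes.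
      have hDx : D.x 0 = 0 := by
        have h1 := hpair (coords ((0, 0, 0, Oct.basis ℝ 0, 0, 0) : J ℝ))
        rw [ofCoords_coords, pairing_eq] at h1
        have h2 : ∀ j, coords ((0, 0, 0, Oct.basis ℝ 0, 0, 0) : J ℝ) (Sum.inr (q j)) = 0 := by
          rintro ⟨i, j⟩
          fin_cases i <;> fin_cases j <;> simp [coords, q, Oct.coeffs, Oct.basis]
        simp only [h2, mul_zero, Finset.sum_const_zero] at h1
        simpa [Oct.bil_eq, Oct.basis] using h1
      exact hF.fourierCoeff_eq_zero (add_mem_integral hT hD) (by simp [ha]) (by simp [hb])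
        (by simp [hDx, hx0])
  rw [hF.fourierCoeff_eq_zero hT rfl rfl hx0] at hslice
  rw [siegelFourierCoeff, ← hslice]
  congr 1
  funext t
  have h0 : combine e t 0 (Sum.inl 0) = t 0 := combine_inl e _ _ 0
  have h1 : combine e t 0 (Sum.inl 1) = t 1 := combine_inl e _ _ 1
  have h2 : combine e t 0 (Sum.inl 2) = t 2 := combine_inl e _ _ 2
  have h3 : combine e t 0 (Sum.inr (0, 0)) = t 3 := combine_inl e _ _ 3
  have h4 : combine e t 0 (Sum.inr (1, 0)) = t 4 := combine_inl e _ _ 4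
  have h5 : combine e t 0 (Sum.inr (2, 0)) = t 5 := combine_inl e _ _ 5
  have h6 : ∀ i (j : Fin 7), combine e t 0 (Sum.inr (i, j.succ)) = 0 :=
    fun i j => combine_inr e _ _ (i, j)
  -- With the coordinates along `α₁, …, α₇` set to `0`, the off-diagonal entries are multiples of
  -- `α₀ = 1`, so the slice is the Siegel half space.
  have hpt : siegelEmbed (siegelPoint t) = toComplex (ofCoords (combine e t 0)) (one ℝ) := by
    apply ext6
    · simp [siegelEmbed, siegelPoint, toComplex, ofCoords, h0]
    · simp [siegelEmbed, siegelPoint, toComplex, ofCoords, h1]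
    · simp [siegelEmbed, siegelPoint, toComplex, ofCoords, h2]
    all_goals
      apply Oct.ext8 <;> simp [siegelEmbed, siegelPoint, toComplex, ofCoords,
        Fin.sum_univ_succ (n := 7), h3, h4, h5, h6, Oct.basis, Oct.scalar]
  rw [fourierIntegrand, restrict, ← hpt]
  congr 3
  simp only [pairing_eq, siegelEmbed, siegelPoint, toComplex, Oct.bil_eq, Oct.scalar, hS,
    Matrix.trace_fin_three, a_mk, b_mk, c_mk, x_mk, y_mk, z_mk, hx0, hy0, hz0]
  simp [Matrix.mul_apply, Fin.sum_univ_three]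
  ring

/-! ### Finiteness of the set of semidefinite lifts -/

namespace J

lemma minor_nonneg_of_mem_closure {T : J ℝ} (hT : T ∈ closure posCone) :
    0 ≤ T.a * T.b - Oct.N T.x := by
  have hclosed : IsClosed {T : J ℝ | 0 ≤ T.a * T.b - Oct.N T.x} := by
    refine isClosed_le continuous_const ?_
    unfold J.a J.b J.x Oct.N
    fun_prop
  exact closure_minimal (fun T h => (posCone_minor_pos h).le) hclosed hT

lemma swap12_mem_closure {T : J ℝ} (hT : T ∈ closure posCone) : swap12 T ∈ closure posCone :=
  map_mem_closure (LinearMap.continuous_of_finiteDimensional (swap12Equiv (R := ℝ)).toLinearMap) hT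
    fun _ => swap12_mem_posCone

lemma swap23_mem_closure {T : J ℝ} (hT : T ∈ closure posCone) : swap23 T ∈ closure posCone :=
  map_mem_closure (LinearMap.continuous_of_finiteDimensional (swap23Equiv (R := ℝ)).toLinearMap) hT
    fun _ => swap23_mem_posCone

/-- Each coefficient is a signed sum of four coordinates or twice one coordinate, and `x_j² ≤ M`
gives `|x_j| ≤ M + 1`. -/
lemma abs_coeffs_le {x : Oct ℝ} {M : ℝ} (h : Oct.N x ≤ M) (i : Fin 8) :
    |Oct.coeffs x i| ≤ 4 * (M + 1) := by
  have hj : ∀ j, |x j| ≤ M + 1 := fun j => by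
    have h1 : x j ^ 2 ≤ Oct.N x :=
      Finset.single_le_sum (fun i _ => sq_nonneg (x i)) (Finset.mem_univ j)
    rw [abs_le]
    constructor <;> nlinarith
  simp only [abs_le] at hj ⊢
  have h0 := hj 0
  have h1 := hj 1
  have h2 := hj 2
  have h3 := hj 3
  have h4 := hj 4
  have h5 := hj 5
  have h6 := hj 6
  have h7 := hj 7
  fin_cases i <;> simp only [Oct.coeffs] <;> constructor <;> simp <;> linarith

/-- Only finitely many elements of `𝔍(ℤ)_{≥0}` have given diagonal entries. -/
lemma finite_integralNonneg (a b c : ℝ) :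
    {T : J ℝ | T ∈ integralNonneg ∧ T.a = a ∧ T.b = b ∧ T.c = c}.Finite := by
  -- `M` dominates the diagonal entries and, because the three `2 × 2` minors are nonnegative, the
  -- norms of the off-diagonal entries.
  set M := |a| + |b| + |c| + |a * b| + |a * c| + |b * c| with hM
  obtain ⟨K, hK⟩ := exists_nat_ge (4 * (M + 1))
  refine ((finite_Icc (fun _ : Idx => -(K : ℤ)) fun _ => (K : ℤ)).image
    fun n => ofCoords fun i => (n i : ℝ)).subset ?_
  rintro T ⟨⟨hT, hcl⟩, ha, hb, hc⟩
  have h12 := minor_nonneg_of_mem_closure hcl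
  have h13 := minor_nonneg_of_mem_closure (swap23_mem_closure hcl)
  have h23 := minor_nonneg_of_mem_closure (swap23_mem_closure (swap12_mem_closure hcl))
  simp only [swap12, swap23, a_mk, b_mk, c_mk, x_mk, y_mk, z_mk, ha, hb, hc] at h12 h13 h23
  have p1 := abs_nonneg a
  have p2 := abs_nonneg b
  have p3 := abs_nonneg c
  have p4 := abs_nonneg (a * b)
  have p5 := abs_nonneg (a * c)
  have p6 := abs_nonneg (b * c)
  have hle : ∀ i, |coords T i| ≤ K := by
    rintro (i | ⟨i, j⟩)
    · refine le_trans ?_ hK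
      fin_cases i
      · change |T.a| ≤ _; rw [ha]; linarith
      · change |T.b| ≤ _; rw [hb]; linarith
      · change |T.c| ≤ _; rw [hc]; linarith
    · refine le_trans ?_ hK
      fin_cases i
      · exact abs_coeffs_le (by linarith [le_abs_self (a * b)]) j
      · exact abs_coeffs_le (by linarith [le_abs_self (a * c)]) j
      · exact abs_coeffs_le (by linarith [le_abs_self (b * c)]) j
  obtain ⟨n, hn⟩ := exists_coords_eq hT
  refine ⟨n, ⟨fun i => ?_, fun i => ?_⟩, by
    change ofCoords _ = T
    rw [← hn, ofCoords_coords]⟩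
  · have := (abs_le.1 (hle i)).1
    rw [hn] at this
    change -(K : ℤ) ≤ n i
    change -(K : ℝ) ≤ (n i : ℝ) at this
    exact_mod_cast this
  · have := (abs_le.1 (hle i)).2
    rw [hn] at this
    change n i ≤ (K : ℤ)
    change (n i : ℝ) ≤ (K : ℝ) at this
    exact_mod_cast this

end J

end ExcDomain

end

theorem mainTheorem10 (S : Matrix (Fin 3) (Fin 3) ℝ) (a b c : ℝ)
    (hS : S = !![1, 1 / 2, a; 1 / 2, 1, b; a, b, c])
    (hS_mem : S ∈ ExcDomain.halfIntegralNonneg) :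
    (¬ ∃ T ∈ ExcDomain.J.integralPos, T.symPart = S) ∧
    {T : ExcDomain.J ℝ | T ∈ ExcDomain.J.integralNonneg ∧ T.symPart = S}.Finite ∧
    ∀ (k : ℤ) (F : ExcDomain.J ℂ → ℂ), ExcDomain.IsCuspForm k F →
      ExcDomain.restrictedCoeff F S = 0 ∧
      ExcDomain.siegelFourierCoeff (ExcDomain.restrict F) S = 0 := by
  have key : ∀ T : ExcDomain.J ℝ, T.symPart = S →
      T.a = 1 ∧ T.b = 1 ∧ T.c = c ∧ T.x 0 = 1 / 2 := fun T hT => by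
    rw [hS] at hT
    exact ⟨congrFun (congrFun hT 0) 0, congrFun (congrFun hT 1) 1, congrFun (congrFun hT 2) 2,
      congrFun (congrFun hT 0) 1⟩
  refine ⟨?_, ?_, fun k F hF => ⟨?_, hF.siegelFourierCoeff_eq_zero hS hS_mem⟩⟩
  · rintro ⟨T, ⟨hT, hpos⟩, hTS⟩
    obtain ⟨ha, hb, -, hx⟩ := key T hTS
    have h1 := ExcDomain.J.posCone_minor_pos hpos
    have h2 := ExcDomain.Oct.one_le_N hT.2.2.2.1 hx
    rw [ha, hb] at h1
    linarith
  · refine (ExcDomain.J.finite_integralNonneg 1 1 c).subset ?_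
    rintro T ⟨hT, hTS⟩
    obtain ⟨ha, hb, hc, -⟩ := key T hTS
    exact ⟨hT, ha, hb, hc⟩
  · refine finsum_mem_eq_zero_of_forall_eq_zero ?_
    rintro T ⟨hT, hTS⟩
    obtain ⟨ha, hb, -, hx⟩ := key T hTS
    exact hF.fourierCoeff_eq_zero hT.1 ha hb hx
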